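/- Let $L,a>0$ and $\Omega=\mathbb T_L^2\times[0,a]$ with $\mathbb T_L^2=(\mathbb R/L\mathbb Z)^2$. Let $H(\mathrm{curl})$ be the space of $E\in L^2(\Omega;\mathbb C^3)$ whose distributional curl is in $L^2(\Omega;\mathbb C^3)$, and let $H_0(\mathrm{curl})$ be the closure, in the graph norm $(\|E\|_{L^2}^2+\|\nabla\times E\|_{L^2}^2)^{1/2}$, of the smooth laterally periodic vector fields on $\Omega$ with $E_x=E_y=0$ at $z=0$ and $z=a$. Put $$V_{\mathrm{PEC}}=\{E\in H_0(\mathrm{curl}):\nabla\cdot E=0\},$$ where the divergence is taken in the sense of distributions on $\mathbb T_L^2\times(0,a)$. Let $H_{\mathrm{PEC}}$ be the $L^2$-closure of $V_{\mathrm{PEC}}$, and let $h_0=(L^2a)^{-1/2}e_z$, $H_{\mathrm{phys}}=H_{\mathrm{PEC}}\ominus\operatorname{span}\{h_0\}$, $V_{\mathrm{phys}}=V_{\mathrm{PEC}}\cap H_{\mathrm{phys}}$. For $m\in\mathbb Z^2$, $n\in\mathbb N_0$ put $k_m=\frac{2\pi}{L}m$, $\nu_n=\frac{\pi n}{a}$,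 $\lambda_{m,n}=|k_m|^2+\nu_n^2$, $\phi_m(r)=L^{-1}e^{\mathrm i k_m\cdot r}$, $s_n(z)=\sqrt{2/a}\,\sin(\nu_nz)$ and $c_n(z)=\sqrt{2/a}\,\cos(\nu_nz)$ for $n\ge1$, and $c_0(z)=a^{-1/2}$. Let $\mathfrak C_{\mathrm{PEC}}$ be the space of families $a_{m,n}\in\mathbb C^2$ ($m\in\mathbb Z^2$, $n\ge1$), $b_{m,n}\in\mathbb C$ ($m\in\mathbb Z^2$, $n\ge0$) such that $$\sum_{m}\sum_{n\ge1}(1+\lambda_{m,n})\left(|a_{m,n}|^2+|b_{m,n}|^2\right)+\sum_m(1+|k_m|^2)|b_{m,0}|^2<\infty$$ and $\mathrm i k_m\cdot a_{m,n}-\nu_nb_{m,n}=0$ for all $m\in\mathbb Z^2$, $n\ge1$. Let $\mathfrak C_{\mathrm{phys}}=\{(a,b)\in\mathfrak C_{\mathrm{PEC}}:b_{0,0}=0\}$. Then the reconstruction map $(a,b)\mapsto E$, $$(E_x,E_y)=\sum_{m}\sum_{n\ge1}a_{m,n}\phi_m(r)s_n(z),\qquad E_z=\sum_m\sum_{n\ge0}b_{m,n}\phi_m(r)c_n(z)$$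 (with convergence in $L^2$), is a linear bijection from $\mathfrak C_{\mathrm{PEC}}$ onto $V_{\mathrm{PEC}}$, and every coefficient family whose series converges in $L^2$ to an element of $V_{\mathrm{PEC}}$ lies in $\mathfrak C_{\mathrm{PEC}}$. Under this identification, $$\|\nabla\times E\|_{L^2}^2=\sum_{m}\sum_{n\ge1}\lambda_{m,n}\left(|a_{m,n}|^2+|b_{m,n}|^2\right)+\sum_m|k_m|^2|b_{m,0}|^2 .$$ Moreover, a family in $\mathfrak C_{\mathrm{PEC}}$ lies in $\mathfrak C_{\mathrm{phys}}$ if and only if the corresponding field lies in $V_{\mathrm{phys}}$; that is, $\mathfrak C_{\mathrm{phys}}$ is identified with $V_{\mathrm{phys}}$. -/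

import Mathlib

open MeasureTheory
open scoped ContDiff InnerProductSpace

noncomputable section

namespace PECSlab

/-! ### The slab `𝕋²_L × [0, a]` and its square-integrable vector fields

The lateral torus `𝕋²_L = (ℝ / L ℤ)²` is represented by its fundamental cell `(0, L)²`;
smooth functions on it are the smooth functions of `(x, y)` that are `L`-periodic in both
variables. -/

/-- Points `(x, y, z)`. -/
abbrev Pt : Type := ℝ × ℝ × ℝ

/-- Complex three-vectors with the Hermitian norm. -/
abbrev Vec3 : Type := EuclideanSpace ℂ (Fin 3)

/-- A fundamental cell of the slab. -/
def cell (L a : ℝ) : Set Pt := Set.Ioo 0 L ×ˢ Set.Ioo 0 L ×ˢ Set.Ioo 0 a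

/-- Lebesgue measure on the slab. -/
def slabMeasure (L a : ℝ) : Measure Pt := volume.restrict (cell L a)

/-- `L²(𝕋²_L × [0, a]; ℂ³)`. -/
abbrev L2Field (L a : ℝ) : Type := Lp Vec3 2 (slabMeasure L a)

theorem memLp_of_continuous (L a : ℝ) {F : Pt → Vec3} (hF : Continuous F) :
    MemLp F 2 (slabMeasure L a) := by
  have hsub : cell L a ⊆ Set.Icc 0 L ×ˢ Set.Icc 0 L ×ˢ Set.Icc 0 a :=
    Set.prod_mono Set.Ioo_subset_Icc_self
      (Set.prod_mono Set.Ioo_subset_Icc_self Set.Ioo_subset_Icc_self)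
  have hK : IsCompact (Set.Icc 0 L ×ˢ Set.Icc 0 L ×ˢ Set.Icc 0 a : Set Pt) :=
    isCompact_Icc.prod (isCompact_Icc.prod isCompact_Icc)
  have hm : MeasurableSet (cell L a) :=
    measurableSet_Ioo.prod (measurableSet_Ioo.prod measurableSet_Ioo)
  obtain ⟨C, hC⟩ := hK.exists_bound_of_continuousOn hF.continuousOn
  have : IsFiniteMeasure (slabMeasure L a) :=
    ⟨by
      rw [slabMeasure, Measure.restrict_apply_univ]
      exact (measure_mono hsub).trans_lt hK.measure_lt_top⟩
  refine MemLp.of_bound hF.aestronglyMeasurable C ?_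
  exact (ae_restrict_iff' hm).2 (Filter.Eventually.of_forall fun p hp => hC p (hsub hp))

/-- The class in `L²` of a continuous field. -/
def ofContinuous (L a : ℝ) (F : Pt → Vec3) (hF : Continuous F) : L2Field L a :=
  (memLp_of_continuous L a hF).toLp F

theorem ofContinuous_zero (L a : ℝ) {F : Pt → Vec3} (hF : Continuous F) (h : ∀ p, F p = 0) :
    ofContinuous L a F hF = 0 := by
  obtain rfl : F = 0 := funext h
  exact MemLp.toLp_zero (memLp_of_continuous L a hF)

theorem ofContinuous_add (L a : ℝ) {F G H : Pt → Vec3} (hF : Continuous F) (hG : Continuous G)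
    (hH : Continuous H) (h : ∀ p, H p = F p + G p) :
    ofContinuous L a H hH = ofContinuous L a F hF + ofContinuous L a G hG := by
  obtain rfl : H = F + G := funext h
  exact MemLp.toLp_add (memLp_of_continuous L a hF) (memLp_of_continuous L a hG)

theorem ofContinuous_smul (L a : ℝ) (c : ℂ) {F H : Pt → Vec3} (hF : Continuous F)
    (hH : Continuous H) (h : ∀ p, H p = c • F p) :
    ofContinuous L a H hH = c • ofContinuous L a F hF := by
  obtain rfl : H = c • F := funext h
  exact MemLp.toLp_const_smul c (memLp_of_continuous L a hF)

/-! ### Classical differential operators -/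

def ex : Pt := (1, 0, 0)
def ey : Pt := (0, 1, 0)
def ez : Pt := (0, 0, 1)

/-- The derivative of a scalar function in the direction `v`. -/
def pd (v : Pt) (f : Pt → ℂ) (p : Pt) : ℂ := fderiv ℝ f p v

/-- The classical gradient. -/
def grad (f : Pt → ℂ) (p : Pt) : Vec3 := !₂[pd ex f p, pd ey f p, pd ez f p]

/-- The classical curl. -/
def curl (F : Pt → Vec3) (p : Pt) : Vec3 :=
  !₂[pd ey (fun q => F q 2) p - pd ez (fun q => F q 1) p,
     pd ez (fun q => F q 0) p - pd ex (fun q => F q 2) p,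
     pd ex (fun q => F q 1) p - pd ey (fun q => F q 0) p]

theorem continuous_pd (v : Pt) {f : Pt → ℂ} (hf : ContDiff ℝ ∞ f) : Continuous (pd v f) :=
  (hf.continuous_fderiv (by simp)).clm_apply continuous_const

theorem contDiff_comp {F : Pt → Vec3} (hF : ContDiff ℝ ∞ F) (i : Fin 3) :
    ContDiff ℝ ∞ (fun q => F q i) := by
  have h := ((EuclideanSpace.proj i : Vec3 →L[ℂ] ℂ).restrictScalars
    ℝ).contDiff (n := ∞)
  exact h.comp hF

theorem continuous_vec3 {f g h : Pt → ℂ} (hf : Continuous f) (hg : Continuous g)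
    (hh : Continuous h) : Continuous (fun p => (!₂[f p, g p, h p] : Vec3)) := by
  refine (PiLp.continuous_toLp 2 _).comp (continuous_pi fun i => ?_)
  fin_cases i
  · exact hf
  · exact hg
  · exact hh

theorem continuous_grad {f : Pt → ℂ} (hf : ContDiff ℝ ∞ f) : Continuous (grad f) :=
  continuous_vec3 (continuous_pd _ hf) (continuous_pd _ hf) (continuous_pd _ hf)

theorem continuous_curl {F : Pt → Vec3} (hF : ContDiff ℝ ∞ F) : Continuous (curl F) :=
  continuous_vec3
    ((continuous_pd _ (contDiff_comp hF 2)).sub (continuous_pd _ (contDiff_comp hF 1)))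
    ((continuous_pd _ (contDiff_comp hF 0)).sub (continuous_pd _ (contDiff_comp hF 2)))
    ((continuous_pd _ (contDiff_comp hF 1)).sub (continuous_pd _ (contDiff_comp hF 0)))

theorem pd_add (v : Pt) {f g : Pt → ℂ} (hf : ContDiff ℝ ∞ f) (hg : ContDiff ℝ ∞ g) (p : Pt) :
    pd v (fun q => f q + g q) p = pd v f p + pd v g p := by
  have h1 : DifferentiableAt ℝ f p := hf.contDiffAt.differentiableAt (by simp)
  have h2 : DifferentiableAt ℝ g p := hg.contDiffAt.differentiableAt (by simp)
  simp [pd, fderiv_fun_add h1 h2]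

theorem pd_smul (v : Pt) (c : ℂ) {f : Pt → ℂ} (hf : ContDiff ℝ ∞ f) (p : Pt) :
    pd v (fun q => c * f q) p = c * pd v f p := by
  have h1 : DifferentiableAt ℝ f p := hf.contDiffAt.differentiableAt (by simp)
  simp [pd, fderiv_const_mul h1 c]

theorem curl_add {F G : Pt → Vec3} (hF : ContDiff ℝ ∞ F) (hG : ContDiff ℝ ∞ G) (p : Pt) :
    curl (fun q => F q + G q) p = curl F p + curl G p := by
  have h := fun (v : Pt) (i : Fin 3) =>
    pd_add v (contDiff_comp hF i) (contDiff_comp hG i) p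
  ext i
  fin_cases i <;> simp [curl, h] <;> ring

theorem curl_smul (c : ℂ) {F : Pt → Vec3} (hF : ContDiff ℝ ∞ F) (p : Pt) :
    curl (fun q => c • F q) p = c • curl F p := by
  have h := fun (v : Pt) (i : Fin 3) => pd_smul v c (contDiff_comp hF i) p
  ext i
  fin_cases i <;> simp [curl, h] <;> ring

/-! ### Smooth periodic fields, weak curl and weak divergence -/

/-- `L`-periodicity in `x` and in `y`. -/
def LateralPeriodic {X : Type} (L : ℝ) (f : Pt → X) : Prop :=
  ∀ x y z : ℝ, f (x + L, y, z) = f (x, y, z) ∧ f (x, y + L, z) = f (x, y, z)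

/-- Test functions on `𝕋²_L × (0, a)`: smooth, laterally periodic, and supported in a compact
subinterval of `(0, a)` in the plate variable. -/
structure IsTest {X : Type} [NormedAddCommGroup X] [NormedSpace ℝ X] (L a : ℝ)
    (f : Pt → X) : Prop where
  smooth : ContDiff ℝ ∞ f
  periodic : LateralPeriodic L f
  support : ∃ α β : ℝ, 0 < α ∧ β < a ∧ ∀ x y z : ℝ, f (x, y, z) ≠ 0 → α ≤ z ∧ z ≤ β

/-- Smooth laterally periodic fields on the closed slab with vanishing tangential components on
the plates `z = 0` and `z = a`. -/
structure IsSmoothPEC (L a : ℝ) (F : Pt → Vec3) : Prop where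
  smooth : ContDiff ℝ ∞ F
  periodic : LateralPeriodic L F
  bottom : ∀ x y : ℝ, F (x, y, 0) 0 = 0 ∧ F (x, y, 0) 1 = 0
  top : ∀ x y : ℝ, F (x, y, a) 0 = 0 ∧ F (x, y, a) 1 = 0

theorem integrable_inner {L a : ℝ} {F : Pt → Vec3} (hF : Continuous F) (E : L2Field L a) :
    Integrable (fun p => ⟪F p, E p⟫_ℂ) (slabMeasure L a) := by
  refine (L2.integrable_inner (𝕜 := ℂ) (ofContinuous L a F hF) E).congr ?_
  filter_upwards [(memLp_of_continuous L a hF).coeFn_toLp] with p hp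
  rw [ofContinuous, hp]

theorem integral_inner_add {L a : ℝ} {F : Pt → Vec3} (hF : Continuous F) (E E' : L2Field L a) :
    ∫ p, ⟪F p, (E + E' : L2Field L a) p⟫_ℂ ∂(slabMeasure L a) =
      ∫ p, ⟪F p, E p⟫_ℂ ∂(slabMeasure L a) + ∫ p, ⟪F p, E' p⟫_ℂ ∂(slabMeasure L a) := by
  rw [← integral_add (integrable_inner hF E) (integrable_inner hF E')]
  refine integral_congr_ae ?_
  filter_upwards [Lp.coeFn_add E E'] with p hp
  rw [hp, Pi.add_apply, inner_add_right]

theorem integral_inner_smul {L a : ℝ} (F : Pt → Vec3) (c : ℂ) (E : L2Field L a) :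
    ∫ p, ⟪F p, (c • E : L2Field L a) p⟫_ℂ ∂(slabMeasure L a) =
      c * ∫ p, ⟪F p, E p⟫_ℂ ∂(slabMeasure L a) := by
  rw [← integral_const_mul]
  refine integral_congr_ae ?_
  filter_upwards [Lp.coeFn_smul c E] with p hp
  rw [hp, Pi.smul_apply, inner_smul_right]

theorem integral_inner_zero {L a : ℝ} (F : Pt → Vec3) :
    ∫ p, ⟪F p, (0 : L2Field L a) p⟫_ℂ ∂(slabMeasure L a) = 0 := by
  have h := integral_inner_smul F (0 : ℂ) (0 : L2Field L a)
  rwa [zero_smul, zero_mul] at h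

/-- `G = ∇ × E` in the sense of distributions on `𝕋²_L × (0, a)`. The inner product conjugates
the test field. -/
def HasWeakCurl {L a : ℝ} (E G : L2Field L a) : Prop :=
  ∀ ψ : Pt → Vec3, IsTest L a ψ →
    ∫ p, ⟪curl ψ p, E p⟫_ℂ ∂(slabMeasure L a) = ∫ p, ⟪ψ p, G p⟫_ℂ ∂(slabMeasure L a)

theorem HasWeakCurl.add {L a : ℝ} {E E' G G' : L2Field L a} (h : HasWeakCurl E G)
    (h' : HasWeakCurl E' G') : HasWeakCurl (E + E') (G + G') := fun ψ hψ => by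
  rw [integral_inner_add (continuous_curl hψ.smooth), integral_inner_add hψ.smooth.continuous,
    h ψ hψ, h' ψ hψ]

theorem HasWeakCurl.smul {L a : ℝ} {E G : L2Field L a} (c : ℂ) (h : HasWeakCurl E G) :
    HasWeakCurl (c • E) (c • G) := fun ψ hψ => by
  rw [integral_inner_smul, integral_inner_smul, h ψ hψ]

theorem HasWeakCurl.zero (L a : ℝ) : HasWeakCurl (0 : L2Field L a) 0 := fun ψ _ => by
  rw [integral_inner_zero, integral_inner_zero]

/-- The fields with `∇ · E = 0` in the sense of distributions on `𝕋²_L × (0, a)`. -/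
def divFree (L a : ℝ) : Submodule ℂ (L2Field L a) where
  carrier := {E | ∀ f : Pt → ℂ, IsTest L a f →
    ∫ p, ⟪grad f p, E p⟫_ℂ ∂(slabMeasure L a) = 0}
  zero_mem' := fun f _ => integral_inner_zero _
  add_mem' := fun hE hE' f hf => by
    rw [integral_inner_add (continuous_grad hf.smooth), hE f hf, hE' f hf, add_zero]
  smul_mem' := fun c _ hE f hf => by
    rw [integral_inner_smul, hE f hf, mul_zero]

/-- `H(curl)`. -/
def Hcurl (L a : ℝ) : Submodule ℂ (L2Field L a) where
  carrier := {E | ∃ G : L2Field L a, HasWeakCurl E G}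
  zero_mem' := ⟨0, HasWeakCurl.zero L a⟩
  add_mem' := fun ⟨G, hG⟩ ⟨G', hG'⟩ => ⟨G + G', hG.add hG'⟩
  smul_mem' := fun c _ ⟨G, hG⟩ => ⟨c • G, hG.smul c⟩

/-- The pairs `(F, ∇ × F)` of smooth perfect-conductor fields, as classes in `L² × L²`. -/
def smoothPECGraph (L a : ℝ) : Submodule ℂ (L2Field L a × L2Field L a) where
  carrier := {w | ∃ (F : Pt → Vec3) (hF : IsSmoothPEC L a F),
    w = (ofContinuous L a F hF.smooth.continuous,
      ofContinuous L a (curl F) (continuous_curl hF.smooth))}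
  zero_mem' := by
    refine ⟨fun _ => 0, ⟨contDiff_const, fun _ _ _ => ⟨rfl, rfl⟩, fun _ _ => ⟨rfl, rfl⟩,
      fun _ _ => ⟨rfl, rfl⟩⟩, ?_⟩
    have h : ∀ p, curl (fun _ => (0 : Vec3)) p = 0 := fun p => by
      ext i
      fin_cases i <;> simp [curl, pd]
    rw [ofContinuous_zero L a _ fun _ => rfl, ofContinuous_zero L a _ h]
    rfl
  add_mem' := by
    rintro _ _ ⟨F, hF, rfl⟩ ⟨G, hG, rfl⟩
    refine ⟨fun q => F q + G q, ⟨hF.smooth.add hG.smooth, fun x y z => ?_, fun x y => ?_,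
      fun x y => ?_⟩, ?_⟩
    · simp [(hF.periodic x y z).1, (hF.periodic x y z).2, (hG.periodic x y z).1,
        (hG.periodic x y z).2]
    · simp [(hF.bottom x y).1, (hF.bottom x y).2, (hG.bottom x y).1, (hG.bottom x y).2]
    · simp [(hF.top x y).1, (hF.top x y).2, (hG.top x y).1, (hG.top x y).2]
    · rw [ofContinuous_add L a hF.smooth.continuous hG.smooth.continuous _ fun _ => rfl,
        ofContinuous_add L a (continuous_curl hF.smooth) (continuous_curl hG.smooth) _
          (curl_add hF.smooth hG.smooth)]
      rfl
  smul_mem' := by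
    rintro c _ ⟨F, hF, rfl⟩
    refine ⟨fun q => c • F q, ⟨hF.smooth.const_smul c, fun x y z => ?_, fun x y => ?_,
      fun x y => ?_⟩, ?_⟩
    · simp [(hF.periodic x y z).1, (hF.periodic x y z).2]
    · simp [(hF.bottom x y).1, (hF.bottom x y).2]
    · simp [(hF.top x y).1, (hF.top x y).2]
    · rw [ofContinuous_smul L a c hF.smooth.continuous _ fun _ => rfl,
        ofContinuous_smul L a c (continuous_curl hF.smooth) _ (curl_smul c hF.smooth)]
      rfl

/-- `H₀(curl)`: the closure of the smooth perfect-conductor fields in `H(curl)` for the graph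
norm `(‖E‖² + ‖∇ × E‖²)^(1/2)`. The graph norm of `E` is equivalent to the norm of the pair
`(E, ∇ × E)` in `L² × L²`, so `E ∈ H(curl)` lies in this closure exactly when `(E, ∇ × E)` is
in the closure of the pairs `(F, ∇ × F)`. -/
def Hzcurl (L a : ℝ) : Submodule ℂ (L2Field L a) where
  carrier := {E | ∃ G : L2Field L a, HasWeakCurl E G ∧
    (E, G) ∈ (smoothPECGraph L a).topologicalClosure}
  zero_mem' := ⟨0, HasWeakCurl.zero L a, Submodule.zero_mem _⟩
  add_mem' := fun ⟨G, hG, h⟩ ⟨G', hG', h'⟩ => ⟨G + G', hG.add hG', Submodule.add_mem _ h h'⟩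
  smul_mem' := fun c _ ⟨G, hG, h⟩ => ⟨c • G, hG.smul c, Submodule.smul_mem _ c h⟩

theorem Hzcurl_le_Hcurl (L a : ℝ) : Hzcurl L a ≤ Hcurl L a := fun _ ⟨G, hG, _⟩ => ⟨G, hG⟩

/-! ### Form domains -/

/-- `V_PEC = {E ∈ H₀(curl) : ∇ · E = 0}`. -/
def VPEC (L a : ℝ) : Submodule ℂ (L2Field L a) := Hzcurl L a ⊓ divFree L a

/-- `H_PEC`, the `L²`-closure of `V_PEC`. -/
def HPEC (L a : ℝ) : Submodule ℂ (L2Field L a) := (VPEC L a).topologicalClosure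

/-- The normalized static normal mode `(L² a)^(-1/2) e_z`. -/
def hzero (L a : ℝ) : L2Field L a :=
  ofContinuous L a (fun _ => !₂[0, 0, (((Real.sqrt (L ^ 2 * a))⁻¹ : ℝ) : ℂ)]) continuous_const

/-- `H_phys = H_PEC ⊖ span {h₀}`. -/
def Hphys (L a : ℝ) : Submodule ℂ (L2Field L a) :=
  HPEC L a ⊓ (Submodule.span ℂ {hzero L a})ᗮ

/-- `V_phys = V_PEC ∩ H_phys`. -/
def Vphys (L a : ℝ) : Submodule ℂ (L2Field L a) := VPEC L a ⊓ Hphys L a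

/-! ### Mixed Fourier modes and coefficient families -/

/-- `k_m = (2π / L) m`, first component. -/
def kx (L : ℝ) (m : ℤ × ℤ) : ℝ := 2 * Real.pi / L * m.1

/-- `k_m = (2π / L) m`, second component. -/
def ky (L : ℝ) (m : ℤ × ℤ) : ℝ := 2 * Real.pi / L * m.2

/-- `|k_m|²`. -/
def kSq (L : ℝ) (m : ℤ × ℤ) : ℝ := kx L m ^ 2 + ky L m ^ 2

/-- `ν_n = π n / a`. -/
def nu (a : ℝ) (n : ℕ) : ℝ := Real.pi * n / a

/-- `λ_{m,n} = |k_m|² + ν_n²`. -/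
def lam (L a : ℝ) (m : ℤ × ℤ) (n : ℕ) : ℝ := kSq L m + nu a n ^ 2

/-- `φ_m(x, y) = L⁻¹ exp(i k_m · (x, y))`. -/
def phi (L : ℝ) (m : ℤ × ℤ) (x y : ℝ) : ℂ :=
  (L : ℂ)⁻¹ * Complex.exp (Complex.I * ((kx L m * x + ky L m * y : ℝ) : ℂ))

/-- `s_n(z) = √(2/a) sin(ν_n z)`. -/
def sMode (a : ℝ) (n : ℕ) (z : ℝ) : ℝ := Real.sqrt (2 / a) * Real.sin (nu a n * z)

/-- `c_0(z) = a^(-1/2)` and `c_n(z) = √(2/a) cos(ν_n z)` for `n ≥ 1`. -/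
def cMode (a : ℝ) (n : ℕ) (z : ℝ) : ℝ :=
  if n = 0 then (Real.sqrt a)⁻¹ else Real.sqrt (2 / a) * Real.cos (nu a n * z)

theorem continuous_phi (L : ℝ) (m : ℤ × ℤ) : Continuous fun p : Pt => phi L m p.1 p.2.1 := by
  unfold phi
  fun_prop

theorem continuous_sMode (a : ℝ) (n : ℕ) : Continuous fun p : Pt => (sMode a n p.2.2 : ℂ) := by
  unfold sMode
  fun_prop

theorem continuous_cMode (a : ℝ) (n : ℕ) : Continuous fun p : Pt => (cMode a n p.2.2 : ℂ) := by
  unfold cMode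
  split_ifs <;> fun_prop

/-- The field with tangential part `u φ_m(x, y) s_n(z)` and zero normal part. -/
def tangentialField (L a : ℝ) (m : ℤ × ℤ) (n : ℕ) (u : EuclideanSpace ℂ (Fin 2)) :
    L2Field L a :=
  ofContinuous L a
    (fun p => !₂[u 0 * (phi L m p.1 p.2.1 * sMode a n p.2.2),
      u 1 * (phi L m p.1 p.2.1 * sMode a n p.2.2), 0])
    (continuous_vec3
      (continuous_const.mul ((continuous_phi L m).mul (continuous_sMode a n)))
      (continuous_const.mul ((continuous_phi L m).mul (continuous_sMode a n)))
      continuous_const)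

/-- The field with zero tangential part and normal part `v φ_m(x, y) c_n(z)`. -/
def normalField (L a : ℝ) (m : ℤ × ℤ) (n : ℕ) (v : ℂ) : L2Field L a :=
  ofContinuous L a (fun p => !₂[0, 0, v * (phi L m p.1 p.2.1 * cMode a n p.2.2)])
    (continuous_vec3 continuous_const continuous_const
      (continuous_const.mul ((continuous_phi L m).mul (continuous_cMode a n))))

/-- Coefficient families `(a, b)`: `a_{m,n} ∈ ℂ²` for `m ∈ ℤ²`, `n ≥ 1`, and `b_{m,n} ∈ ℂ` for
`m ∈ ℤ²`, `n ≥ 0`. -/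
abbrev Coeff : Type :=
  ((ℤ × ℤ) × ℕ+ → EuclideanSpace ℂ (Fin 2)) × ((ℤ × ℤ) × ℕ → ℂ)

/-- `E` is the `L²`-sum of the mixed series with coefficients `c = (a, b)`:
`E_∥ = ∑ a_{m,n} φ_m s_n` and `E_z = ∑ b_{m,n} φ_m c_n`. -/
def Reconstructs {L a : ℝ} (c : Coeff) (E : L2Field L a) : Prop :=
  ∃ T N : L2Field L a,
    HasSum (fun j : (ℤ × ℤ) × ℕ+ => tangentialField L a j.1 j.2 (c.1 j)) T ∧
    HasSum (fun j : (ℤ × ℤ) × ℕ => normalField L a j.1 j.2 (c.2 j)) N ∧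
    E = T + N

theorem kSq_nonneg (L : ℝ) (m : ℤ × ℤ) : 0 ≤ kSq L m := by
  unfold kSq
  positivity

theorem lam_nonneg (L a : ℝ) (m : ℤ × ℤ) (n : ℕ) : 0 ≤ lam L a m n :=
  add_nonneg (kSq_nonneg L m) (sq_nonneg _)

theorem norm_add_sq_le {X : Type} [SeminormedAddCommGroup X] (x y : X) :
    ‖x + y‖ ^ 2 ≤ 2 * ‖x‖ ^ 2 + 2 * ‖y‖ ^ 2 := by
  have h := norm_add_le x y
  nlinarith [norm_nonneg (x + y), sq_nonneg (‖x‖ - ‖y‖), norm_nonneg x, norm_nonneg y]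

/-- `𝔠_PEC`: weighted summability and `i k_m · a_{m,n} - ν_n b_{m,n} = 0` for `n ≥ 1`. -/
def CPEC (L a : ℝ) : Submodule ℂ Coeff where
  carrier := {c |
    Summable (fun j : (ℤ × ℤ) × ℕ+ =>
      (1 + lam L a j.1 j.2) * (‖c.1 j‖ ^ 2 + ‖c.2 (j.1, (j.2 : ℕ))‖ ^ 2)) ∧
    Summable (fun m : ℤ × ℤ => (1 + kSq L m) * ‖c.2 (m, 0)‖ ^ 2) ∧
    ∀ (m : ℤ × ℤ) (n : ℕ+),
      Complex.I * (kx L m * c.1 (m, n) 0 + ky L m * c.1 (m, n) 1) -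
        nu a n * c.2 (m, (n : ℕ)) = 0}
  zero_mem' := by simp [summable_zero]
  add_mem' := by
    rintro c d ⟨h1, h2, h3⟩ ⟨g1, g2, g3⟩
    refine ⟨?_, ?_, fun m n => ?_⟩
    · refine Summable.of_nonneg_of_le (fun j => ?_) (fun j => ?_)
        ((h1.mul_left 2).add (g1.mul_left 2))
      · have := lam_nonneg L a j.1 j.2
        positivity
      · have hl := lam_nonneg L a j.1 j.2
        have e1 := norm_add_sq_le (c.1 j) (d.1 j)
        have e2 := norm_add_sq_le (c.2 (j.1, (j.2 : ℕ))) (d.2 (j.1, (j.2 : ℕ)))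
        simp only [Prod.fst_add, Prod.snd_add, Pi.add_apply]
        calc _ ≤ (1 + lam L a j.1 j.2) * ((2 * ‖c.1 j‖ ^ 2 + 2 * ‖d.1 j‖ ^ 2) +
              (2 * ‖c.2 (j.1, (j.2 : ℕ))‖ ^ 2 + 2 * ‖d.2 (j.1, (j.2 : ℕ))‖ ^ 2)) := by
                gcongr
          _ = _ := by ring
    · refine Summable.of_nonneg_of_le (fun m => ?_) (fun m => ?_)
        ((h2.mul_left 2).add (g2.mul_left 2))
      · have := kSq_nonneg L m
        positivity
      · have hl := kSq_nonneg L m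
        have e2 := norm_add_sq_le (c.2 (m, 0)) (d.2 (m, 0))
        simp only [Prod.snd_add, Pi.add_apply]
        calc _ ≤ (1 + kSq L m) * (2 * ‖c.2 (m, 0)‖ ^ 2 + 2 * ‖d.2 (m, 0)‖ ^ 2) := by gcongr
          _ = _ := by ring
    · simp only [Prod.fst_add, Prod.snd_add, Pi.add_apply, PiLp.add_apply]
      linear_combination h3 m n + g3 m n
  smul_mem' := by
    rintro t c ⟨h1, h2, h3⟩
    refine ⟨?_, ?_, fun m n => ?_⟩
    · refine (h1.mul_left (‖t‖ ^ 2)).congr fun j => ?_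
      simp only [Prod.smul_fst, Prod.smul_snd, Pi.smul_apply, norm_smul]
      ring
    · refine (h2.mul_left (‖t‖ ^ 2)).congr fun m => ?_
      simp only [Prod.smul_snd, Pi.smul_apply, norm_smul]
      ring
    · simp only [Prod.smul_fst, Prod.smul_snd, Pi.smul_apply, PiLp.smul_apply, smul_eq_mul]
      linear_combination t * h3 m n

/-- `𝔠_phys`: the families in `𝔠_PEC` with `b_{0,0} = 0`. -/
def Cphys (L a : ℝ) : Submodule ℂ Coeff where
  carrier := {c | c ∈ CPEC L a ∧ c.2 ((0, 0), 0) = 0}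
  zero_mem' := ⟨Submodule.zero_mem _, rfl⟩
  add_mem' := fun ⟨h, h0⟩ ⟨g, g0⟩ => ⟨Submodule.add_mem _ h g, by
    simp only [Prod.snd_add, Pi.add_apply, h0, g0, add_zero]⟩
  smul_mem' := fun t _ ⟨h, h0⟩ => ⟨Submodule.smul_mem _ t h, by
    simp only [Prod.smul_snd, Pi.smul_apply, h0, smul_zero]⟩

end PECSlab

end

open PECSlab

noncomputable section

namespace PECSlab

open Filter
open scoped Topology

/-! ### Partial derivatives along coordinate lines -/

/-! The proof diagonalizes the curl by two Hilbert bases of `L²`. In the electric basis the two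
tangential components carry `φ_m s_n` and the normal one carries `φ_m c_n`; in the magnetic basis
sines and cosines are exchanged. Both are orthonormal after the vanishing sine modes with `n = 0`
are dropped, and both are complete (`modeBasis`). Completeness comes from Stone–Weierstrass for the
cosine functions and is carried over to sines by multiplying with `sin (π z / a)`, which is positive
inside the cell.

On each frequency the curl sends one basis to the other by a cross product with the wave vector. If
`(E, G)` is a limit of smooth perfect-conductor pairs, then `⟪curl ψ, E⟫ = ⟪ψ, G⟫` holds for every
smooth periodic `ψ`, with no condition on `ψ` at the plates (`inner_curl_of_mem_closure`). Taking
magnetic modes for `ψ` expresses the coefficients of `G` through those of `E`. Divergence-freeness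
is only given against test functions supported away from the plates. It extends to `φ_m s_n` because
the sines vanish linearly at the plates and so absorb the derivative of the cutoff
(`integral_inner_grad_scalarMode`); this is the algebraic constraint. Lagrange's identity `|κ × w|²
+ |κ · w|² = |κ|² |w|²` with `κ · w = 0`, followed by Parseval for `G`, gives the curl norm
(`hasSum_norm_sq_curl`) and with it the weighted summability.

Conversely, finite sums of electric modes are smooth perfect-conductor fields. The weights make the
series and its curls converge together in `L²`, so the limit lies in the closed graph, and the
constraint kills the pairing with every test gradient term by term (`exists_mem_VPEC`). Uniqueness
of coefficients is orthonormality. The reduced space is handled by observing that `h₀` is itself the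
normal mode with `m = 0`, `n = 0`. -/

theorem hasDerivAt_pd_ex {f : Pt → ℂ} (hf : ContDiff ℝ ∞ f) (x y z : ℝ) :
    HasDerivAt (fun t => f (t, y, z)) (pd ex f (x, y, z)) x := by
  have h1 : HasFDerivAt f (fderiv ℝ f (x, y, z)) (x, y, z) :=
    (hf.contDiffAt.differentiableAt (by simp)).hasFDerivAt
  have h2 : HasDerivAt (fun t : ℝ => ((t, y, z) : Pt)) ex x :=
    (hasDerivAt_id x).prodMk (hasDerivAt_const x (y, z))
  exact h1.comp_hasDerivAt x h2

theorem hasDerivAt_pd_ey {f : Pt → ℂ} (hf : ContDiff ℝ ∞ f) (x y z : ℝ) :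
    HasDerivAt (fun t => f (x, t, z)) (pd ey f (x, y, z)) y := by
  have h1 : HasFDerivAt f (fderiv ℝ f (x, y, z)) (x, y, z) :=
    (hf.contDiffAt.differentiableAt (by simp)).hasFDerivAt
  have h2 : HasDerivAt (fun t : ℝ => ((x, t, z) : Pt)) ey y :=
    (hasDerivAt_const y x).prodMk ((hasDerivAt_id y).prodMk (hasDerivAt_const y z))
  exact h1.comp_hasDerivAt y h2

theorem hasDerivAt_pd_ez {f : Pt → ℂ} (hf : ContDiff ℝ ∞ f) (x y z : ℝ) :
    HasDerivAt (fun t => f (x, y, t)) (pd ez f (x, y, z)) z := by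
  have h1 : HasFDerivAt f (fderiv ℝ f (x, y, z)) (x, y, z) :=
    (hf.contDiffAt.differentiableAt (by simp)).hasFDerivAt
  have h2 : HasDerivAt (fun t : ℝ => ((x, y, t) : Pt)) ez z :=
    (hasDerivAt_const z x).prodMk ((hasDerivAt_const z y).prodMk (hasDerivAt_id z))
  exact h1.comp_hasDerivAt z h2

/-! ### Scalar modes -/

/-- `c_n` for `true` and `s_n` for `false`. -/
def zMode (a : ℝ) : Bool → ℕ → ℝ → ℝ
  | true => cMode a
  | false => sMode a

/-- The sign in `c_n' = -ν_n s_n` and `s_n' = ν_n c_n`. -/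
def zSign : Bool → ℝ
  | true => -1
  | false => 1

theorem nu_zero (a : ℝ) : nu a 0 = 0 := by simp [nu]

theorem sMode_zero (a z : ℝ) : sMode a 0 z = 0 := by simp [sMode, nu]

theorem zMode_false_zero (a z : ℝ) : zMode a false 0 z = 0 := sMode_zero a z

theorem contDiff_zMode (a : ℝ) (b : Bool) (n : ℕ) : ContDiff ℝ ∞ (zMode a b n) := by
  cases b
  · change ContDiff ℝ ∞ (fun z => Real.sqrt (2 / a) * Real.sin (nu a n * z))
    fun_prop
  · change ContDiff ℝ ∞
      (fun z => if n = 0 then (Real.sqrt a)⁻¹ else Real.sqrt (2 / a) * Real.cos (nu a n * z))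
    split_ifs <;> fun_prop

theorem hasDerivAt_zMode (a : ℝ) (b : Bool) (n : ℕ) (z : ℝ) :
    HasDerivAt (zMode a b n) (zSign b * nu a n * zMode a (!b) n z) z := by
  have hl : HasDerivAt (fun z => nu a n * z) (nu a n) z := by
    simpa using (hasDerivAt_id z).const_mul (nu a n)
  rcases Nat.eq_zero_or_pos n with rfl | hn
  -- The constant `c_0` is normalized differently from the other cosines, so `n = 0` is treated
  -- apart: both modes are constant and `ν_0 = 0`.
  · have : zMode a b 0 = fun _ => zMode a b 0 0 := by
      funext z
      cases b <;> simp [zMode, sMode, cMode, nu]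
    rw [this, nu_zero]
    simpa using hasDerivAt_const z (zMode a b 0 0)
  · cases b
    · refine (hl.sin.const_mul (Real.sqrt (2 / a))).congr_deriv ?_
      simp [zSign, zMode, cMode, hn.ne']
      ring
    · have : zMode a true n = fun z => Real.sqrt (2 / a) * Real.cos (nu a n * z) := by
        funext z
        simp [zMode, cMode, hn.ne']
      rw [this]
      refine (hl.cos.const_mul (Real.sqrt (2 / a))).congr_deriv ?_
      simp [zSign, zMode, sMode]
      ring

theorem zMode_false_left (a : ℝ) (n : ℕ) : zMode a false n 0 = 0 := by
  simp [zMode, sMode]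

theorem zMode_false_right {a : ℝ} (ha : 0 < a) (n : ℕ) : zMode a false n a = 0 := by
  have : nu a n * a = n * Real.pi := by
    unfold nu
    field_simp
  simp [zMode, sMode, this, Real.sin_nat_mul_pi]

theorem phi_eq_exp_mul_exp (L : ℝ) (m : ℤ × ℤ) (x y : ℝ) :
    phi L m x y = (L : ℂ)⁻¹ * (Complex.exp (Complex.I * kx L m * x) *
      Complex.exp (Complex.I * ky L m * y)) := by
  rw [phi, ← Complex.exp_add]
  push_cast
  ring_nf

theorem exp_kx_period {L : ℝ} (hL : 0 < L) (k : ℤ) (x : ℝ) :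
    Complex.exp (Complex.I * ((2 * Real.pi / L * k : ℝ) : ℂ) * ((x + L : ℝ) : ℂ)) =
      Complex.exp (Complex.I * ((2 * Real.pi / L * k : ℝ) : ℂ) * (x : ℂ)) := by
  have hL' : (L : ℂ) ≠ 0 := by exact_mod_cast hL.ne'
  have : Complex.I * ((2 * Real.pi / L * k : ℝ) : ℂ) * ((x + L : ℝ) : ℂ) =
      Complex.I * ((2 * Real.pi / L * k : ℝ) : ℂ) * (x : ℂ) + k * (2 * Real.pi * Complex.I) := by
    push_cast
    field_simp
  rw [this, Complex.exp_add, Complex.exp_int_mul_two_pi_mul_I, mul_one]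

/-- `φ_m c_n` for `true` and `φ_m s_n` for `false`. -/
def scalarMode (L a : ℝ) (b : Bool) (m : ℤ × ℤ) (n : ℕ) (p : Pt) : ℂ :=
  phi L m p.1 p.2.1 * zMode a b n p.2.2

theorem contDiff_phi (L : ℝ) (m : ℤ × ℤ) :
    ContDiff ℝ ∞ fun p : Pt => phi L m p.1 p.2.1 := by
  unfold phi
  have h : ContDiff ℝ ∞ fun p : Pt => ((kx L m * p.1 + ky L m * p.2.1 : ℝ) : ℂ) :=
    Complex.ofRealCLM.contDiff.comp
      ((contDiff_const.mul contDiff_fst).add (contDiff_const.mul (contDiff_fst.comp contDiff_snd)))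
  exact contDiff_const.mul (contDiff_const.mul h).cexp

theorem contDiff_scalarMode (L a : ℝ) (b : Bool) (m : ℤ × ℤ) (n : ℕ) :
    ContDiff ℝ ∞ (scalarMode L a b m n) :=
  (contDiff_phi L m).mul
    (Complex.ofRealCLM.contDiff.comp ((contDiff_zMode a b n).comp (by fun_prop)))

theorem periodic_scalarMode {L : ℝ} (hL : 0 < L) (a : ℝ) (b : Bool) (m : ℤ × ℤ) (n : ℕ) :
    LateralPeriodic L (scalarMode L a b m n) := by
  intro x y z
  constructor
  · simp only [scalarMode, phi_eq_exp_mul_exp, kx, exp_kx_period hL]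
  · simp only [scalarMode, phi_eq_exp_mul_exp, ky, exp_kx_period hL]

theorem hasDerivAt_phi_left (L : ℝ) (m : ℤ × ℤ) (x y : ℝ) :
    HasDerivAt (fun t : ℝ => phi L m t y) (Complex.I * kx L m * phi L m x y) x := by
  have h0 : HasDerivAt (fun t : ℝ => Complex.I * ((kx L m * t + ky L m * y : ℝ) : ℂ))
      (Complex.I * kx L m) x := by
    have h : HasDerivAt (fun t : ℝ => kx L m * t + ky L m * y) (kx L m) x := by
      simpa using ((hasDerivAt_id x).const_mul (kx L m)).add_const (ky L m * y)
    exact h.ofReal_comp.const_mul Complex.I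
  refine (h0.cexp.const_mul (L : ℂ)⁻¹).congr_deriv ?_
  rw [phi]
  ring

theorem hasDerivAt_phi_right (L : ℝ) (m : ℤ × ℤ) (x y : ℝ) :
    HasDerivAt (fun t : ℝ => phi L m x t) (Complex.I * ky L m * phi L m x y) y := by
  have h0 : HasDerivAt (fun t : ℝ => Complex.I * ((kx L m * x + ky L m * t : ℝ) : ℂ))
      (Complex.I * ky L m) y := by
    have h : HasDerivAt (fun t : ℝ => kx L m * x + ky L m * t) (ky L m) y := by
      simpa using ((hasDerivAt_id y).const_mul (ky L m)).const_add (kx L m * x)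
    exact h.ofReal_comp.const_mul Complex.I
  refine (h0.cexp.const_mul (L : ℂ)⁻¹).congr_deriv ?_
  rw [phi]
  ring

theorem pd_ex_scalarMode (L a : ℝ) (b : Bool) (m : ℤ × ℤ) (n : ℕ) (p : Pt) :
    pd ex (scalarMode L a b m n) p = Complex.I * kx L m * scalarMode L a b m n p := by
  obtain ⟨x, y, z⟩ := p
  refine (hasDerivAt_pd_ex (contDiff_scalarMode L a b m n) x y z).unique ?_
  refine ((hasDerivAt_phi_left L m x y).mul_const (zMode a b n z : ℂ)).congr_deriv ?_
  simp only [scalarMode]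
  ring

theorem pd_ey_scalarMode (L a : ℝ) (b : Bool) (m : ℤ × ℤ) (n : ℕ) (p : Pt) :
    pd ey (scalarMode L a b m n) p = Complex.I * ky L m * scalarMode L a b m n p := by
  obtain ⟨x, y, z⟩ := p
  refine (hasDerivAt_pd_ey (contDiff_scalarMode L a b m n) x y z).unique ?_
  refine ((hasDerivAt_phi_right L m x y).mul_const (zMode a b n z : ℂ)).congr_deriv ?_
  simp only [scalarMode]
  ring

theorem pd_ez_scalarMode (L a : ℝ) (b : Bool) (m : ℤ × ℤ) (n : ℕ) (p : Pt) :
    pd ez (scalarMode L a b m n) p = zSign b * nu a n * scalarMode L a (!b) m n p := by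
  obtain ⟨x, y, z⟩ := p
  refine (hasDerivAt_pd_ez (contDiff_scalarMode L a b m n) x y z).unique ?_
  refine ((hasDerivAt_zMode a b n z).ofReal_comp.const_mul (phi L m x y)).congr_deriv ?_
  simp only [scalarMode]
  push_cast
  ring

/-! ### Vector modes -/

/-- The field `f e_i`. -/
def axisField (i : Fin 3) (f : Pt → ℂ) (p : Pt) : Vec3 := EuclideanSpace.single i (f p)

theorem contDiff_axisField (i : Fin 3) {f : Pt → ℂ} (hf : ContDiff ℝ ∞ f) :
    ContDiff ℝ ∞ (axisField i f) := by
  refine (contDiff_piLp 2).2 fun j => ?_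
  by_cases h : j = i
  · subst h
    simpa [axisField] using hf
  · simpa [axisField, h] using contDiff_const

theorem periodic_axisField {L : ℝ} (i : Fin 3) {f : Pt → ℂ} (hf : LateralPeriodic L f) :
    LateralPeriodic L (axisField i f) := fun x y z => by
  simp only [axisField, (hf x y z).1, (hf x y z).2, and_self]

theorem continuous_axisField (i : Fin 3) {f : Pt → ℂ} (hf : Continuous f) :
    Continuous (axisField i f) := by
  refine (PiLp.continuous_toLp 2 _).comp (continuous_pi fun j => ?_)
  by_cases h : j = i
  · subst h
    simpa [axisField] using hf
  · simpa [axisField, h] using continuous_const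

theorem continuous_scalarMode (L a : ℝ) (b : Bool) (m : ℤ × ℤ) (n : ℕ) :
    Continuous (scalarMode L a b m n) := (contDiff_scalarMode L a b m n).continuous

/-- The class in `L²` of the field `φ_m c_n e_i` for `true` and `φ_m s_n e_i` for `false`. -/
def modeField (L a : ℝ) (b : Bool) (i : Fin 3) (m : ℤ × ℤ) (n : ℕ) : L2Field L a :=
  ofContinuous L a (axisField i (scalarMode L a b m n))
    (continuous_axisField i (continuous_scalarMode L a b m n))

theorem inner_ofContinuous {L a : ℝ} {F : Pt → Vec3} (hF : Continuous F) (E : L2Field L a) :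
    ⟪ofContinuous L a F hF, E⟫_ℂ = ∫ p, ⟪F p, E p⟫_ℂ ∂(slabMeasure L a) := by
  rw [L2.inner_def]
  refine integral_congr_ae ?_
  filter_upwards [(memLp_of_continuous L a hF).coeFn_toLp] with p hp
  rw [ofContinuous, hp]

theorem coeFn_ofContinuous {L a : ℝ} {F : Pt → Vec3} (hF : Continuous F) :
    ofContinuous L a F hF =ᵐ[slabMeasure L a] F :=
  (memLp_of_continuous L a hF).coeFn_toLp

theorem inner_ofContinuous_ofContinuous {L a : ℝ} {F G : Pt → Vec3} (hF : Continuous F)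
    (hG : Continuous G) :
    ⟪ofContinuous L a F hF, ofContinuous L a G hG⟫_ℂ =
      ∫ p, ⟪F p, G p⟫_ℂ ∂(slabMeasure L a) := by
  rw [inner_ofContinuous]
  refine integral_congr_ae ?_
  filter_upwards [coeFn_ofContinuous (L := L) (a := a) hG] with p hp
  rw [hp]

theorem ofContinuous_congr (L a : ℝ) {F G : Pt → Vec3} (hF : Continuous F) (hG : Continuous G)
    (h : ∀ p, F p = G p) : ofContinuous L a F hF = ofContinuous L a G hG := by
  obtain rfl : F = G := funext h
  rfl

theorem inner_axisField (i : Fin 3) (f : Pt → ℂ) (p : Pt) (v : Vec3) :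
    ⟪axisField i f p, v⟫_ℂ = starRingEnd ℂ (f p) * v i := by
  simp [axisField, EuclideanSpace.inner_single_left]

/-- Allows all three components to share the index set `ℤ² × ℕ`: the superfluous sine modes with `n
= 0` contribute nothing. -/
theorem modeField_false_zero (L a : ℝ) (i : Fin 3) (m : ℤ × ℤ) :
    modeField L a false i m 0 = 0 :=
  ofContinuous_zero L a _ fun p => by
    simp [axisField, scalarMode, zMode_false_zero]

/-! ### Orthonormality of the modes -/

theorem slabMeasure_eq_prod (L a : ℝ) :
    slabMeasure L a = (volume.restrict (Set.Ioo 0 L)).prod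
      ((volume.restrict (Set.Ioo 0 L)).prod (volume.restrict (Set.Ioo 0 a))) := by
  rw [Measure.prod_restrict, Measure.prod_restrict]
  rfl

theorem integral_slab_mul (L a : ℝ) (f g h : ℝ → ℂ) :
    ∫ p : Pt, f p.1 * (g p.2.1 * h p.2.2) ∂(slabMeasure L a) =
      (∫ x in Set.Ioo 0 L, f x) * ((∫ y in Set.Ioo 0 L, g y) * ∫ z in Set.Ioo 0 a, h z) := by
  rw [slabMeasure_eq_prod, integral_prod_mul f (fun q : ℝ × ℝ => g q.1 * h q.2),
    integral_prod_mul g h]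

theorem setIntegral_Ioo_eq_sub {l : ℝ} (hl : 0 < l) {f f' : ℝ → ℂ}
    (h : ∀ x, HasDerivAt f (f' x) x) (hc : Continuous f') :
    ∫ x in Set.Ioo 0 l, f' x = f l - f 0 := by
  rw [← integral_Ioc_eq_integral_Ioo, ← intervalIntegral.integral_of_le hl.le]
  exact intervalIntegral.integral_eq_sub_of_hasDerivAt (fun x _ => h x)
    (hc.intervalIntegrable _ _)

theorem setIntegral_Ioo_eq_sub_real {l : ℝ} (hl : 0 < l) {f f' : ℝ → ℝ}
    (h : ∀ x, HasDerivAt f (f' x) x) (hc : Continuous f') :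
    ∫ x in Set.Ioo 0 l, f' x = f l - f 0 := by
  rw [← integral_Ioc_eq_integral_Ioo, ← intervalIntegral.integral_of_le hl.le]
  exact intervalIntegral.integral_eq_sub_of_hasDerivAt (fun x _ => h x)
    (hc.intervalIntegrable _ _)

theorem integrableOn_Ioo_of_continuous {l : ℝ} {f : ℝ → ℝ} (hf : Continuous f) :
    IntegrableOn f (Set.Ioo 0 l) :=
  (hf.continuousOn.integrableOn_Icc).mono_set Set.Ioo_subset_Icc_self

/-- `exp (2πi k x / L)`. -/
def lateralExp (L : ℝ) (k : ℤ) (x : ℝ) : ℂ :=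
  Complex.exp (Complex.I * ((2 * Real.pi / L * k : ℝ) : ℂ) * (x : ℂ))

theorem lateralExp_conj_mul (L : ℝ) (k l : ℤ) (x : ℝ) :
    starRingEnd ℂ (lateralExp L k x) * lateralExp L l x = lateralExp L (l - k) x := by
  simp only [lateralExp]
  rw [← Complex.exp_conj, ← Complex.exp_add]
  congr 1
  simp only [map_mul, Complex.conj_I, Complex.conj_ofReal]
  push_cast
  ring

theorem integral_lateralExp {L : ℝ} (hL : 0 < L) (k : ℤ) :
    ∫ x in Set.Ioo 0 L, lateralExp L k x = if k = 0 then (L : ℂ) else 0 := by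
  split_ifs with hk
  · subst hk
    simp [lateralExp, hL.le]
  · have hω : Complex.I * ((2 * Real.pi / L * k : ℝ) : ℂ) ≠ 0 := by
      refine mul_ne_zero Complex.I_ne_zero ?_
      have hk' : (k : ℝ) ≠ 0 := by exact_mod_cast hk
      have := Real.pi_pos.ne'
      exact_mod_cast (by positivity : 2 * Real.pi / L * (k : ℝ) ≠ 0)
    have hd : ∀ x : ℝ, HasDerivAt
        (fun x => (Complex.I * ((2 * Real.pi / L * k : ℝ) : ℂ))⁻¹ * lateralExp L k x)
        (lateralExp L k x) x := fun x => by
      have h0 : HasDerivAt (fun x : ℝ => Complex.I * ((2 * Real.pi / L * k : ℝ) : ℂ) * (x : ℂ))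
          (Complex.I * ((2 * Real.pi / L * k : ℝ) : ℂ)) x := by
        simpa using (Complex.ofRealCLM.hasDerivAt (x := x)).const_mul
          (Complex.I * ((2 * Real.pi / L * k : ℝ) : ℂ))
      refine (h0.cexp.const_mul _).congr_deriv ?_
      rw [lateralExp, mul_comm (Complex.exp _), inv_mul_cancel_left₀ hω]
    rw [setIntegral_Ioo_eq_sub hL hd (by unfold lateralExp; fun_prop), ← mul_sub]
    have h := exp_kx_period hL k 0
    rw [zero_add] at h
    simp only [lateralExp, h, sub_self, mul_zero]

theorem continuous_zMode (a : ℝ) (b : Bool) (n : ℕ) : Continuous (zMode a b n) :=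
  (contDiff_zMode a b n).continuous

theorem zSign_not (b : Bool) : zSign (!b) = -zSign b := by cases b <;> simp [zSign]

theorem zMode_mul_not_left (a : ℝ) (b : Bool) (n n' : ℕ) :
    zMode a b n 0 * zMode a (!b) n' 0 = 0 := by
  cases b <;> simp [zMode_false_left]

theorem zMode_mul_not_right {a : ℝ} (ha : 0 < a) (b : Bool) (n n' : ℕ) :
    zMode a b n a * zMode a (!b) n' a = 0 := by
  cases b <;> simp [zMode_false_right ha]

theorem nu_injective {a : ℝ} (ha : 0 < a) {n n' : ℕ} (h : nu a n = nu a n') : n = n' := by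
  have := Real.pi_pos.ne'
  unfold nu at h
  field_simp at h
  exact_mod_cast h

theorem nu_nonneg {a : ℝ} (ha : 0 < a) (n : ℕ) : 0 ≤ nu a n := by
  have := Real.pi_pos
  unfold nu
  positivity

/-- Sturm–Liouville argument: `(ν_n² - ν_{n'}²)` times the integrand is the derivative of a
Wronskian. Each Wronskian term contains a sine, so it vanishes at both plates. -/
theorem integral_zMode_mul_of_ne {a : ℝ} (ha : 0 < a) (b : Bool) {n n' : ℕ} (hn : n ≠ n') :
    ∫ z in Set.Ioo 0 a, zMode a b n z * zMode a b n' z = 0 := by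
  have hd : ∀ z, HasDerivAt
      (fun z => zSign b * (nu a n' * (zMode a b n z * zMode a (!b) n' z) -
        nu a n * (zMode a b n' z * zMode a (!b) n z)))
      ((nu a n ^ 2 - nu a n' ^ 2) * (zMode a b n z * zMode a b n' z)) z := fun z => by
    have h1 := ((hasDerivAt_zMode a b n z).mul (hasDerivAt_zMode a (!b) n' z)).const_mul (nu a n')
    have h2 := ((hasDerivAt_zMode a b n' z).mul (hasDerivAt_zMode a (!b) n z)).const_mul (nu a n)
    refine ((h1.sub h2).const_mul (zSign b)).congr_deriv ?_
    have hs : zSign b * zSign b = 1 := by cases b <;> simp [zSign]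
    simp only [zSign_not, Bool.not_not]
    linear_combination (nu a n ^ 2 - nu a n' ^ 2) * (zMode a b n z * zMode a b n' z) * hs
  have h := setIntegral_Ioo_eq_sub_real ha hd
    (continuous_const.mul ((continuous_zMode a b n).mul (continuous_zMode a b n')))
  rw [integral_const_mul] at h
  simp only [zMode_mul_not_left, zMode_mul_not_right ha, mul_zero, sub_self] at h
  refine (mul_eq_zero.1 h).resolve_left fun h0 => hn (nu_injective ha ?_)
  exact (sq_eq_sq₀ (nu_nonneg ha n) (nu_nonneg ha n')).1 (sub_eq_zero.1 h0)

theorem zMode_sq_add_sq {a : ℝ} (ha : 0 < a) (b : Bool) {n : ℕ} (hn : n ≠ 0) (z : ℝ) :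
    zMode a b n z * zMode a b n z + zMode a (!b) n z * zMode a (!b) n z = 2 / a := by
  have h2 : Real.sqrt (2 / a) * Real.sqrt (2 / a) = 2 / a :=
    Real.mul_self_sqrt (by positivity)
  have h3 := Real.sin_sq_add_cos_sq (nu a n * z)
  cases b <;> simp only [zMode, sMode, cMode, hn, if_false, Bool.not_true, Bool.not_false] <;>
    linear_combination (Real.sin (nu a n * z) ^ 2 + Real.cos (nu a n * z) ^ 2) * h2 + 2 / a * h3

/-- The derivative of `s_n c_n` is `ν_n (c_n² - s_n²)` and `s_n c_n` vanishes at both ends, so the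
two squares have equal integrals. Their sum is the constant `2 / a`, hence each integral is `1`. -/
theorem integral_zMode_mul_self {a : ℝ} (ha : 0 < a) (b : Bool) {n : ℕ} (hn : n ≠ 0) :
    ∫ z in Set.Ioo 0 a, zMode a b n z * zMode a b n z = 1 := by
  have hI : ∀ b : Bool, IntegrableOn (fun z => zMode a b n z * zMode a b n z) (Set.Ioo 0 a) :=
    fun b => integrableOn_Ioo_of_continuous ((continuous_zMode a b n).mul (continuous_zMode a b n))
  have hd : ∀ z, HasDerivAt (fun z => zMode a b n z * zMode a (!b) n z)
      ((zSign b * nu a n) * (zMode a (!b) n z * zMode a (!b) n z -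
        zMode a b n z * zMode a b n z)) z := fun z => by
    refine ((hasDerivAt_zMode a b n z).mul (hasDerivAt_zMode a (!b) n z)).congr_deriv ?_
    simp only [zSign_not, Bool.not_not]
    ring
  have h := setIntegral_Ioo_eq_sub_real ha hd (continuous_const.mul
    (((continuous_zMode a (!b) n).mul (continuous_zMode a (!b) n)).sub
      ((continuous_zMode a b n).mul (continuous_zMode a b n))))
  rw [integral_const_mul, integral_sub (hI (!b)) (hI b), zMode_mul_not_left,
    zMode_mul_not_right ha, sub_zero] at h
  have hs : zSign b * nu a n ≠ 0 := by
    have hn' : (n : ℝ) ≠ 0 := by exact_mod_cast hn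
    have := Real.pi_pos.ne'
    refine mul_ne_zero (by cases b <;> simp [zSign]) ?_
    unfold nu
    positivity
  have h1 := (mul_eq_zero.1 h).resolve_left hs
  have h2 : ∫ z in Set.Ioo 0 a, (zMode a b n z * zMode a b n z +
      zMode a (!b) n z * zMode a (!b) n z) = 2 := by
    simp only [zMode_sq_add_sq ha b hn]
    simp [ha.le]
    field_simp
  rw [integral_add (hI b) (hI (!b))] at h2
  linarith

/-- The squared norm of `c_n` for `true` and of `s_n` for `false`. -/
def zNormSq (b : Bool) (n : ℕ) : ℝ := if b = false ∧ n = 0 then 0 else 1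

theorem integral_zMode_mul {a : ℝ} (ha : 0 < a) (b : Bool) (n n' : ℕ) :
    ∫ z in Set.Ioo 0 a, zMode a b n z * zMode a b n' z = if n = n' then zNormSq b n else 0 := by
  split_ifs with h
  · subst h
    rcases eq_or_ne n 0 with rfl | hn
    · cases b
      · simp [zMode_false_zero, zNormSq]
      · have : (Real.sqrt a)⁻¹ * (Real.sqrt a)⁻¹ = a⁻¹ := by
          rw [← mul_inv, Real.mul_self_sqrt ha.le]
        simp [zMode, cMode, zNormSq, this, ha.le, ha.ne']
    · rw [integral_zMode_mul_self ha b hn, zNormSq, if_neg (fun h => hn h.2)]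
  · exact integral_zMode_mul_of_ne ha b h

theorem scalarMode_eq (L a : ℝ) (b : Bool) (m : ℤ × ℤ) (n : ℕ) (p : Pt) :
    scalarMode L a b m n p =
      (L : ℂ)⁻¹ * (lateralExp L m.1 p.1 * (lateralExp L m.2 p.2.1 * zMode a b n p.2.2)) := by
  rw [scalarMode, phi_eq_exp_mul_exp]
  simp only [lateralExp, kx, ky]
  ring

theorem integral_scalarMode_mul {L a : ℝ} (hL : 0 < L) (ha : 0 < a) (b : Bool) (m m' : ℤ × ℤ)
    (n n' : ℕ) :
    ∫ p, starRingEnd ℂ (scalarMode L a b m n p) * scalarMode L a b m' n' p ∂(slabMeasure L a) =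
      if m = m' ∧ n = n' then (zNormSq b n : ℂ) else 0 := by
  have hL' : (L : ℂ) ≠ 0 := by exact_mod_cast hL.ne'
  have e : ∀ p, starRingEnd ℂ (scalarMode L a b m n p) * scalarMode L a b m' n' p =
      ((L : ℂ)⁻¹ * (L : ℂ)⁻¹) * (lateralExp L (m'.1 - m.1) p.1 *
        (lateralExp L (m'.2 - m.2) p.2.1 * ((zMode a b n p.2.2 * zMode a b n' p.2.2 : ℝ) : ℂ))) :=
    fun p => by
      rw [← lateralExp_conj_mul, ← lateralExp_conj_mul, scalarMode_eq, scalarMode_eq]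
      simp only [map_mul, map_inv₀, Complex.conj_ofReal]
      push_cast
      ring
  simp only [e]
  rw [integral_const_mul, integral_slab_mul L a (lateralExp L (m'.1 - m.1))
    (lateralExp L (m'.2 - m.2)) (fun z => ((zMode a b n z * zMode a b n' z : ℝ) : ℂ)),
    integral_lateralExp hL, integral_lateralExp hL, integral_complex_ofReal,
    integral_zMode_mul ha]
  obtain ⟨m1, m2⟩ := m
  obtain ⟨m1', m2'⟩ := m'
  simp only [sub_eq_zero, Prod.mk.injEq]
  by_cases h1 : m1 = m1'
  · by_cases h2 : m2 = m2'
    · by_cases h3 : n = n'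
      · simp [h1, h2, h3]
        field_simp
      · simp [h1, h2, h3]
    · simp [h1, h2, eq_comm]
  · simp [h1, eq_comm]

theorem inner_modeField {L a : ℝ} (hL : 0 < L) (ha : 0 < a) (b : Bool) (i : Fin 3)
    (m m' : ℤ × ℤ) (n n' : ℕ) :
    ⟪modeField L a b i m n, modeField L a b i m' n'⟫_ℂ =
      if m = m' ∧ n = n' then (zNormSq b n : ℂ) else 0 := by
  rw [modeField, modeField, inner_ofContinuous_ofContinuous, ← integral_scalarMode_mul hL ha]
  simp only [inner_axisField]
  simp [axisField]

theorem inner_modeField_of_ne {L a : ℝ} (b b' : Bool) {i j : Fin 3} (h : i ≠ j)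
    (m m' : ℤ × ℤ) (n n' : ℕ) :
    ⟪modeField L a b i m n, modeField L a b' j m' n'⟫_ℂ = 0 := by
  rw [modeField, modeField, inner_ofContinuous_ofContinuous]
  simp only [inner_axisField]
  simp [axisField, h]

/-! ### Completeness of the modes -/

/-- `exp (i k_m · r) cos (π k z / a)`. -/
def cosWave (L a : ℝ) (m : ℤ × ℤ) (k : ℤ) (p : Pt) : ℂ :=
  lateralExp L m.1 p.1 * (lateralExp L m.2 p.2.1 * Complex.cos ((k * (Real.pi * p.2.2 / a) : ℝ)))

theorem lateralExp_add (L : ℝ) (k l : ℤ) (x : ℝ) :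
    lateralExp L k x * lateralExp L l x = lateralExp L (k + l) x := by
  simp only [lateralExp]
  rw [← Complex.exp_add]
  congr 1
  push_cast
  ring

theorem star_lateralExp (L : ℝ) (k : ℤ) (x : ℝ) :
    starRingEnd ℂ (lateralExp L k x) = lateralExp L (-k) x := by
  simp only [lateralExp]
  rw [← Complex.exp_conj]
  congr 1
  simp only [map_mul, Complex.conj_I, Complex.conj_ofReal]
  push_cast
  ring

theorem norm_lateralExp (L : ℝ) (k : ℤ) (x : ℝ) : ‖lateralExp L k x‖ = 1 := by
  rw [lateralExp, mul_assoc, ← Complex.ofReal_mul, Complex.norm_exp_I_mul_ofReal]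

theorem continuous_lateralExp (L : ℝ) (k : ℤ) : Continuous (lateralExp L k) := by
  unfold lateralExp
  fun_prop

theorem continuous_cosWave (L a : ℝ) (m : ℤ × ℤ) (k : ℤ) : Continuous (cosWave L a m k) := by
  unfold cosWave
  have h1 := (continuous_lateralExp L m.1).comp (continuous_fst (X := ℝ) (Y := ℝ × ℝ))
  have h2 := (continuous_lateralExp L m.2).comp
    (continuous_fst.comp (continuous_snd (X := ℝ) (Y := ℝ × ℝ)))
  exact h1.mul (h2.mul (by fun_prop))

theorem norm_cosWave_le (L a : ℝ) (m : ℤ × ℤ) (k : ℤ) (p : Pt) : ‖cosWave L a m k p‖ ≤ 1 := by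
  rw [cosWave, norm_mul, norm_mul, norm_lateralExp, norm_lateralExp, one_mul, one_mul,
    ← Complex.ofReal_cos, Complex.norm_real]
  exact Real.abs_cos_le_one _

/-- The trigonometric polynomials spanned by the functions `exp (i k_m · r) cos (π k z / a)`. -/
def cosPoly (L a : ℝ) : Submodule ℂ (Pt → ℂ) :=
  Submodule.span ℂ (Set.range fun q : (ℤ × ℤ) × ℤ => cosWave L a q.1 q.2)

theorem cosWave_mem (L a : ℝ) (m : ℤ × ℤ) (k : ℤ) : cosWave L a m k ∈ cosPoly L a :=
  Submodule.subset_span ⟨(m, k), rfl⟩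

/-- The map `(exp (2πi x / L), exp (2πi y / L), cos (π z / a))` on the closed slab. -/
def waveMap (L a : ℝ) (p : Pt) : ℂ × ℂ × ℂ :=
  (lateralExp L 1 p.1, lateralExp L 1 p.2.1, Complex.cos ((Real.pi * p.2.2 / a : ℝ)))

theorem continuous_waveMap (L a : ℝ) : Continuous (waveMap L a) := by
  have h1 := (continuous_lateralExp L 1).comp (continuous_fst (X := ℝ) (Y := ℝ × ℝ))
  have h2 := (continuous_lateralExp L 1).comp
    (continuous_fst.comp (continuous_snd (X := ℝ) (Y := ℝ × ℝ)))
  exact h1.prodMk (h2.prodMk (by fun_prop))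

theorem mul_mem_cosPoly {L a : ℝ} {f : Pt → ℂ}
    (hf : ∀ m k, f * cosWave L a m k ∈ cosPoly L a) {h : Pt → ℂ} (hh : h ∈ cosPoly L a) :
    f * h ∈ cosPoly L a := by
  induction hh using Submodule.span_induction with
  | mem x hx =>
    obtain ⟨q, rfl⟩ := hx
    exact hf q.1 q.2
  | zero => rw [mul_zero]; exact Submodule.zero_mem _
  | add x y _ _ hx hy => rw [mul_add]; exact Submodule.add_mem _ hx hy
  | smul c x _ hx => rw [mul_smul_comm]; exact Submodule.smul_mem _ c hx

theorem lateralExp_left_mul_mem (L a : ℝ) (l : ℤ) {h : Pt → ℂ} (hh : h ∈ cosPoly L a) :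
    (fun p : Pt => lateralExp L l p.1) * h ∈ cosPoly L a := by
  refine mul_mem_cosPoly (fun m k => ?_) hh
  convert cosWave_mem L a (l + m.1, m.2) k using 1
  funext p
  simp only [Pi.mul_apply, cosWave, ← lateralExp_add]
  ring

theorem lateralExp_right_mul_mem (L a : ℝ) (l : ℤ) {h : Pt → ℂ} (hh : h ∈ cosPoly L a) :
    (fun p : Pt => lateralExp L l p.2.1) * h ∈ cosPoly L a := by
  refine mul_mem_cosPoly (fun m k => ?_) hh
  convert cosWave_mem L a (m.1, l + m.2) k using 1
  funext p
  simp only [Pi.mul_apply, cosWave, ← lateralExp_add]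
  ring

theorem cos_mul_mem (L a : ℝ) {h : Pt → ℂ} (hh : h ∈ cosPoly L a) :
    (fun p : Pt => Complex.cos ((Real.pi * p.2.2 / a : ℝ))) * h ∈ cosPoly L a := by
  refine mul_mem_cosPoly (fun m k => ?_) hh
  have e : (fun p : Pt => Complex.cos ((Real.pi * p.2.2 / a : ℝ))) * cosWave L a m k =
      (2 : ℂ)⁻¹ • (cosWave L a m (k + 1) + cosWave L a m (k - 1)) := by
    funext p
    have h1 : (((k + 1 : ℤ) * (Real.pi * p.2.2 / a) : ℝ) : ℂ) =
        ((k * (Real.pi * p.2.2 / a) : ℝ) : ℂ) + ((Real.pi * p.2.2 / a : ℝ) : ℂ) := by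
      push_cast; ring
    have h2 : (((k - 1 : ℤ) * (Real.pi * p.2.2 / a) : ℝ) : ℂ) =
        ((k * (Real.pi * p.2.2 / a) : ℝ) : ℂ) - ((Real.pi * p.2.2 / a : ℝ) : ℂ) := by
      push_cast; ring
    simp only [Pi.mul_apply, Pi.smul_apply, Pi.add_apply, smul_eq_mul, cosWave]
    rw [h1, h2, Complex.cos_add, Complex.cos_sub]
    ring
  rw [e]
  exact Submodule.smul_mem _ _ (Submodule.add_mem _ (cosWave_mem _ _ _ _) (cosWave_mem _ _ _ _))

/-! ### Stone–Weierstrass approximation on the cell. -/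

/-- The star algebra of functions on a set in `ℂ³` generated by the three coordinates. -/
def coordAlgebra (K : Set (ℂ × ℂ × ℂ)) : StarSubalgebra ℂ C(K, ℂ) :=
  StarAlgebra.adjoin ℂ {⟨fun q => q.1.1, by fun_prop⟩, ⟨fun q => q.1.2.1, by fun_prop⟩,
    ⟨fun q => q.1.2.2, by fun_prop⟩}

theorem coordAlgebra_separatesPoints (K : Set (ℂ × ℂ × ℂ)) :
    (coordAlgebra K).SeparatesPoints := by
  intro p q hpq
  have hsub := StarAlgebra.subset_adjoin ℂ ({⟨fun q => q.1.1, by fun_prop⟩,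
    ⟨fun q => q.1.2.1, by fun_prop⟩, ⟨fun q => q.1.2.2, by fun_prop⟩} : Set C(K, ℂ))
  by_contra! hcon
  refine hpq (Subtype.ext (Prod.ext ?_ (Prod.ext ?_ ?_)))
  · exact hcon _ ⟨_, hsub (Or.inl rfl), rfl⟩
  · exact hcon _ ⟨_, hsub (Or.inr (Or.inl rfl)), rfl⟩
  · exact hcon _ ⟨_, hsub (Or.inr (Or.inr rfl)), rfl⟩

/-- The closed cell. -/
def closedCell (L a : ℝ) : Set Pt := Set.Icc 0 L ×ˢ Set.Icc 0 L ×ˢ Set.Icc 0 a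

theorem isCompact_closedCell (L a : ℝ) : IsCompact (closedCell L a) :=
  isCompact_Icc.prod (isCompact_Icc.prod isCompact_Icc)

theorem cell_subset_closedCell (L a : ℝ) : cell L a ⊆ closedCell L a :=
  Set.prod_mono Set.Ioo_subset_Icc_self
    (Set.prod_mono Set.Ioo_subset_Icc_self Set.Ioo_subset_Icc_self)

theorem exists_cosPoly_of_mem_coordAlgebra {L a : ℝ} {f : C(waveMap L a '' closedCell L a, ℂ)}
    (hf : f ∈ coordAlgebra (waveMap L a '' closedCell L a)) :
    ∃ h ∈ cosPoly L a, ∀ p (hp : p ∈ closedCell L a),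
      f ⟨waveMap L a p, Set.mem_image_of_mem _ hp⟩ = h p := by
  -- The induction runs over multipliers of `cosPoly` instead of its elements. Products become
  -- successive multiplications, and the star of `h` is carried along for the star step. Multiplying
  -- the constant `1` recovers membership.
  suffices H : ∃ h : Pt → ℂ, (∀ g ∈ cosPoly L a, h * g ∈ cosPoly L a) ∧
      (∀ g ∈ cosPoly L a, star h * g ∈ cosPoly L a) ∧ ∀ p (hp : p ∈ closedCell L a),
      f ⟨waveMap L a p, Set.mem_image_of_mem _ hp⟩ = h p by
    obtain ⟨h, h1, -, h2⟩ := H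
    have hone : cosWave L a (0, 0) 0 = 1 := by
      funext p
      simp [cosWave, lateralExp]
    refine ⟨h, ?_, h2⟩
    have := h1 _ (cosWave_mem L a (0, 0) 0)
    rwa [hone, mul_one] at this
  refine StarAlgebra.adjoin_induction (p := fun f _ => ∃ h : Pt → ℂ,
      (∀ g ∈ cosPoly L a, h * g ∈ cosPoly L a) ∧
      (∀ g ∈ cosPoly L a, star h * g ∈ cosPoly L a) ∧ ∀ p (hp : p ∈ closedCell L a),
      f ⟨waveMap L a p, Set.mem_image_of_mem _ hp⟩ = h p) ?_ ?_ ?_ ?_ ?_ hf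
  · rintro f (rfl | rfl | rfl)
    · refine ⟨fun p => lateralExp L 1 p.1, fun g hg => lateralExp_left_mul_mem L a 1 hg,
        fun g hg => ?_, fun p hp => rfl⟩
      convert lateralExp_left_mul_mem L a (-1) hg using 2
      funext p
      exact star_lateralExp L 1 p.1
    · refine ⟨fun p => lateralExp L 1 p.2.1, fun g hg => lateralExp_right_mul_mem L a 1 hg,
        fun g hg => ?_, fun p hp => rfl⟩
      convert lateralExp_right_mul_mem L a (-1) hg using 2
      funext p
      exact star_lateralExp L 1 p.2.1
    · refine ⟨fun p => Complex.cos ((Real.pi * p.2.2 / a : ℝ)), fun g hg => cos_mul_mem L a hg,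
        fun g hg => ?_, fun p hp => rfl⟩
      convert cos_mul_mem L a hg using 2
      funext p
      simp only [Pi.star_apply]
      rw [← Complex.ofReal_cos]
      exact Complex.conj_ofReal _
  · intro r
    refine ⟨fun _ => r, fun g hg => Submodule.smul_mem _ r hg,
      fun g hg => Submodule.smul_mem _ (star r) hg, fun p hp => rfl⟩
  · rintro f f' - - ⟨h, h1, h2, h3⟩ ⟨h', h1', h2', h3'⟩
    refine ⟨h + h', fun g hg => ?_, fun g hg => ?_, fun p hp => ?_⟩
    · rw [add_mul]; exact Submodule.add_mem _ (h1 g hg) (h1' g hg)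
    · rw [star_add, add_mul]; exact Submodule.add_mem _ (h2 g hg) (h2' g hg)
    · rw [ContinuousMap.add_apply, h3 p hp, h3' p hp, Pi.add_apply]
  · rintro f f' - - ⟨h, h1, h2, h3⟩ ⟨h', h1', h2', h3'⟩
    refine ⟨h * h', fun g hg => ?_, fun g hg => ?_, fun p hp => ?_⟩
    · rw [mul_assoc]; exact h1 _ (h1' g hg)
    · rw [star_mul, mul_assoc]; exact h2' _ (h2 g hg)
    · rw [ContinuousMap.mul_apply, h3 p hp, h3' p hp, Pi.mul_apply]
  · rintro f - ⟨h, h1, h2, h3⟩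
    refine ⟨star h, h2, ?_, fun p hp => ?_⟩
    · rwa [star_star]
    · rw [ContinuousMap.star_apply, h3 p hp, Pi.star_apply]

/-- Equal exponentials differ by `n L` with `|x - x'| ≤ L`, so `n` is `-1`, `0` or `1`, and `n = ±1`
forces both points to be endpoints. -/
theorem eq_or_not_mem_of_lateralExp_eq {L : ℝ} (hL : 0 < L) {x x' : ℝ} (hx : x ∈ Set.Icc 0 L)
    (hx' : x' ∈ Set.Icc 0 L) (h : lateralExp L 1 x = lateralExp L 1 x') :
    x = x' ∨ (x ∉ Set.Ioo 0 L ∧ x' ∉ Set.Ioo 0 L) := by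
  obtain ⟨n, hn⟩ := Complex.exp_eq_exp_iff_exists_int.1 h
  have h1 : x = x' + n * L := by
    have hp : (Real.pi : ℂ) ≠ 0 := by exact_mod_cast Real.pi_pos.ne'
    have hL' : (L : ℂ) ≠ 0 := by exact_mod_cast hL.ne'
    have : (x : ℂ) = x' + n * L := by
      push_cast at hn
      field_simp at hn
      linear_combination hn
    exact_mod_cast this
  have hn1 : (n : ℝ) < 2 := by
    by_contra! hc
    nlinarith [hx.1, hx.2, hx'.1, hx'.2]
  have hn2 : (-2 : ℝ) < n := by
    by_contra! hc
    nlinarith [hx.1, hx.2, hx'.1, hx'.2]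
  have hn1' : n < 2 := by exact_mod_cast hn1
  have hn2' : -2 < n := by exact_mod_cast hn2
  have : n = -1 ∨ n = 0 ∨ n = 1 := by omega
  rcases this with rfl | rfl | rfl
  · right
    push_cast at h1
    exact ⟨fun hc => by linarith [hc.1, hx'.2], fun hc => by linarith [hc.2, hx.1]⟩
  · left
    simpa using h1
  · right
    push_cast at h1
    exact ⟨fun hc => by linarith [hc.2, hx'.1], fun hc => by linarith [hc.1, hx.2]⟩

/-- The cosine is injective on `[0, π]`, so `waveMap` glues only lateral faces. A function vanishing
off the open cell therefore descends to the image. -/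
theorem eq_or_not_mem_of_waveMap_eq {L a : ℝ} (hL : 0 < L) (ha : 0 < a) {p q : Pt}
    (hp : p ∈ closedCell L a) (hq : q ∈ closedCell L a) (h : waveMap L a p = waveMap L a q) :
    p = q ∨ (p ∉ cell L a ∧ q ∉ cell L a) := by
  obtain ⟨x, y, z⟩ := p
  obtain ⟨x', y', z'⟩ := q
  obtain ⟨hx, hy, hz⟩ := hp
  obtain ⟨hx', hy', hz'⟩ := hq
  simp only [waveMap, Prod.mk.injEq] at h
  obtain ⟨h1, h2, h3⟩ := h
  rcases eq_or_not_mem_of_lateralExp_eq hL hx hx' h1 with rfl | ⟨g, g'⟩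
  · rcases eq_or_not_mem_of_lateralExp_eq hL hy hy' h2 with rfl | ⟨g, g'⟩
    · left
      have hpi := Real.pi_pos
      have hm : ∀ t ∈ Set.Icc 0 a, Real.pi * t / a ∈ Set.Icc 0 Real.pi := fun t ht => by
        refine ⟨by have := ht.1; positivity, ?_⟩
        rw [div_le_iff₀ ha]
        exact mul_le_mul_of_nonneg_left ht.2 hpi.le
      have h4 := Real.injOn_cos (hm z hz) (hm z' hz') (by exact_mod_cast h3)
      field_simp at h4
      rw [h4]
    · exact Or.inr ⟨fun hc => g hc.2.1, fun hc => g' hc.2.1⟩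
  · exact Or.inr ⟨fun hc => g hc.1, fun hc => g' hc.1⟩

/-- On the compact image of `waveMap` the coordinate functions separate points, so Stone–Weierstrass
applies there. The map onto the image is a quotient map, so `g` descends to a continuous function on
it. -/
theorem exists_cosPoly_approx {L a : ℝ} (hL : 0 < L) (ha : 0 < a) {g : Pt → ℂ}
    (hg : Continuous g) (hs : ∀ p ∉ cell L a, g p = 0) {ε : ℝ} (hε : 0 < ε) :
    ∃ h ∈ cosPoly L a, ∀ p ∈ cell L a, ‖g p - h p‖ ≤ ε := by
  have : CompactSpace (closedCell L a) :=
    isCompact_iff_compactSpace.1 (isCompact_closedCell L a)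
  have : CompactSpace (waveMap L a '' closedCell L a) := isCompact_iff_compactSpace.1
    ((isCompact_closedCell L a).image (continuous_waveMap L a))
  let θ : C(closedCell L a, waveMap L a '' closedCell L a) :=
    ⟨fun p => ⟨waveMap L a p, Set.mem_image_of_mem _ p.2⟩,
      ((continuous_waveMap L a).comp continuous_subtype_val).subtype_mk _⟩
  have hsurj : Function.Surjective θ := by
    rintro ⟨_, p, hp, rfl⟩
    exact ⟨⟨p, hp⟩, rfl⟩
  have hθ : Topology.IsQuotientMap θ := θ.continuous.isClosedMap.isQuotientMap θ.continuous hsurj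
  let g' : C(closedCell L a, ℂ) := ⟨fun p => g p, hg.comp continuous_subtype_val⟩
  have hfac : Function.FactorsThrough g' θ := by
    intro p q hpq
    rcases eq_or_not_mem_of_waveMap_eq hL ha p.2 q.2 (congrArg Subtype.val hpq) with h | ⟨h, h'⟩
    · rw [Subtype.ext h]
    · change g p = g q
      rw [hs _ h, hs _ h']
  let w : C(waveMap L a '' closedCell L a, ℂ) := hθ.lift g' hfac
  have hw : ∀ p : closedCell L a, w (θ p) = g p := fun p =>
    DFunLike.congr_fun (hθ.lift_comp g' hfac) p
  have hden := ContinuousMap.starSubalgebra_topologicalClosure_eq_top_of_separatesPoints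
    (coordAlgebra (waveMap L a '' closedCell L a)) (coordAlgebra_separatesPoints _)
  have hmem : w ∈ closure (coordAlgebra (waveMap L a '' closedCell L a) :
      Set C(waveMap L a '' closedCell L a, ℂ)) := by
    rw [← StarSubalgebra.topologicalClosure_coe, hden]
    trivial
  obtain ⟨f, hf, hfw⟩ := Metric.mem_closure_iff.1 hmem ε hε
  obtain ⟨h, hh, hfh⟩ := exists_cosPoly_of_mem_coordAlgebra hf
  refine ⟨h, hh, fun p hp => ?_⟩
  have hp' := cell_subset_closedCell L a hp
  rw [← hfh p hp', ← hw ⟨p, hp'⟩, ← dist_eq_norm]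
  exact (ContinuousMap.dist_apply_le_dist _).trans hfw.le

theorem integral_cosPoly_mul_eq_zero {L a : ℝ} {u : Pt → ℂ}
    (hu : Integrable u (slabMeasure L a))
    (h0 : ∀ m k, ∫ p, cosWave L a m k p * u p ∂(slabMeasure L a) = 0) {h : Pt → ℂ}
    (hh : h ∈ cosPoly L a) :
    Integrable (fun p => h p * u p) (slabMeasure L a) ∧
      ∫ p, h p * u p ∂(slabMeasure L a) = 0 := by
  induction hh using Submodule.span_induction with
  | mem x hx =>
    obtain ⟨q, rfl⟩ := hx
    exact ⟨hu.bdd_mul (c := 1) (continuous_cosWave L a q.1 q.2).aestronglyMeasurable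
      (Filter.Eventually.of_forall (norm_cosWave_le L a q.1 q.2)), h0 q.1 q.2⟩
  | zero => simp
  | add x y _ _ hx hy =>
    simp only [Pi.add_apply, add_mul]
    exact ⟨hx.1.add hy.1, by rw [integral_add hx.1 hy.1, hx.2, hy.2, add_zero]⟩
  | smul c x _ hx =>
    simp only [Pi.smul_apply, smul_eq_mul, mul_assoc]
    exact ⟨hx.1.const_mul c, by rw [integral_const_mul, hx.2, mul_zero]⟩

theorem isOpen_cell (L a : ℝ) : IsOpen (cell L a) := isOpen_Ioo.prod (isOpen_Ioo.prod isOpen_Ioo)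

theorem measurableSet_cell (L a : ℝ) : MeasurableSet (cell L a) := (isOpen_cell L a).measurableSet

theorem integrable_continuous_mul {L a : ℝ} {u : Pt → ℂ} (hu : Integrable u (slabMeasure L a))
    {g : Pt → ℂ} (hg : Continuous g) : Integrable (fun p => g p * u p) (slabMeasure L a) := by
  obtain ⟨C, hC⟩ := (isCompact_closedCell L a).exists_bound_of_continuousOn hg.continuousOn
  refine hu.bdd_mul (c := C) hg.aestronglyMeasurable ?_
  exact (ae_restrict_iff' (measurableSet_cell L a)).2
    (Filter.Eventually.of_forall fun p hp => hC p (cell_subset_closedCell L a hp))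

/-- It suffices to test against smooth functions compactly supported in the open cell. These are
uniform limits of elements of `cosPoly`, and uniform approximation is enough because `u` is
integrable. -/
theorem ae_eq_zero_of_integral_cosWave {L a : ℝ} (hL : 0 < L) (ha : 0 < a) {u : Pt → ℂ}
    (hu : Integrable u (slabMeasure L a))
    (h0 : ∀ m k, ∫ p, cosWave L a m k p * u p ∂(slabMeasure L a) = 0) :
    ∀ᵐ p ∂(slabMeasure L a), u p = 0 := by
  rw [slabMeasure, ae_restrict_iff' (measurableSet_cell L a)]
  refine (isOpen_cell L a).ae_eq_zero_of_integral_contDiff_smul_eq_zero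
    (IntegrableOn.locallyIntegrableOn hu) fun g hg _ hgs => ?_
  have hg0 : ∀ p ∉ cell L a, g p = 0 := fun p hp =>
    image_eq_zero_of_notMem_tsupport fun h => hp (hgs h)
  rw [← setIntegral_eq_integral_of_forall_compl_eq_zero (s := cell L a)
    (fun p hp => by rw [hg0 p hp, zero_smul])]
  change ∫ p, g p • u p ∂(slabMeasure L a) = 0
  have hgc : Continuous fun p => (g p : ℂ) := Complex.continuous_ofReal.comp hg.continuous
  have hbound : ∀ ε > 0, ‖∫ p, g p • u p ∂(slabMeasure L a)‖ ≤
      ε * ∫ p, ‖u p‖ ∂(slabMeasure L a) := by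
    intro ε hε
    obtain ⟨h, hh, hgh⟩ := exists_cosPoly_approx hL ha hgc
      (fun p hp => by rw [hg0 p hp, Complex.ofReal_zero]) hε
    obtain ⟨hi, hi0⟩ := integral_cosPoly_mul_eq_zero hu h0 hh
    have hle : ∀ᵐ p ∂(slabMeasure L a), ‖((g p : ℂ) - h p) * u p‖ ≤ ε * ‖u p‖ := by
      refine (ae_restrict_iff' (measurableSet_cell L a)).2 (Filter.Eventually.of_forall ?_)
      intro p hp
      rw [norm_mul]
      exact mul_le_mul_of_nonneg_right (hgh p hp) (norm_nonneg _)
    have hgi : Integrable (fun p => (g p : ℂ) * u p) (slabMeasure L a) :=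
      integrable_continuous_mul hu hgc
    have e : ∫ p, g p • u p ∂(slabMeasure L a) =
        ∫ p, ((g p : ℂ) - h p) * u p ∂(slabMeasure L a) := by
      simp only [sub_mul]
      rw [integral_sub hgi hi, hi0, sub_zero]
      rfl
    rw [e, ← integral_const_mul]
    exact norm_integral_le_of_norm_le (hu.norm.const_mul ε) hle
  have hzero : ‖∫ p, g p • u p ∂(slabMeasure L a)‖ ≤ 0 := by
    have ht : Filter.Tendsto (fun ε : ℝ => ε * ∫ p, ‖u p‖ ∂(slabMeasure L a))
        (nhdsWithin 0 (Set.Ioi 0)) (nhds 0) := by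
      have : Filter.Tendsto (fun ε : ℝ => ε * ∫ p, ‖u p‖ ∂(slabMeasure L a)) (nhds 0)
          (nhds (0 * ∫ p, ‖u p‖ ∂(slabMeasure L a))) := Filter.tendsto_id.mul_const _
      rw [zero_mul] at this
      exact this.mono_left nhdsWithin_le_nhds
    exact ge_of_tendsto ht (eventually_nhdsWithin_of_forall hbound)
  exact norm_le_zero_iff.1 hzero

theorem cosWave_eq_smul_scalarMode {L a : ℝ} (hL : 0 < L) (ha : 0 < a) (m : ℤ × ℤ) (k : ℤ) :
    ∃ c : ℂ, ∀ p, cosWave L a m k p = c * scalarMode L a true m k.natAbs p := by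
  have hL' : (L : ℂ) ≠ 0 := by exact_mod_cast hL.ne'
  have key : ∀ z : ℝ, Real.cos (k * (Real.pi * z / a)) =
      Real.cos (nu a k.natAbs * z) := fun z => by
    rw [← Real.cos_abs (k * (Real.pi * z / a)), ← Real.cos_abs (nu a k.natAbs * z)]
    congr 1
    rw [nu, Nat.cast_natAbs, Int.cast_abs]
    simp only [abs_mul, abs_div, abs_abs]
    ring
  have hz : ∃ d : ℝ, ∀ z : ℝ, Real.cos (k * (Real.pi * z / a)) =
      d * zMode a true k.natAbs z := by
    have h2 : Real.sqrt (2 / a) ≠ 0 := (Real.sqrt_pos.2 (by positivity)).ne'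
    have h3 : Real.sqrt a ≠ 0 := (Real.sqrt_pos.2 ha).ne'
    by_cases hk : k.natAbs = 0
    · refine ⟨Real.sqrt a, fun z => ?_⟩
      rw [key, hk, nu_zero]
      simp [zMode, cMode, h3]
    · refine ⟨(Real.sqrt (2 / a))⁻¹, fun z => ?_⟩
      rw [key]
      simp only [zMode, cMode, hk, if_false]
      rw [inv_mul_cancel_left₀ h2]
  obtain ⟨d, hd⟩ := hz
  refine ⟨L * d, fun p => ?_⟩
  rw [scalarMode_eq, cosWave, ← Complex.ofReal_cos, hd]
  push_cast
  field_simp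

/-- With `θ = π z / a`: `2 cos (k θ) sin θ = sin ((k + 1) θ) - sin ((k - 1) θ)`. Oddness of the sine
turns negative frequencies into natural ones. -/
theorem sin_mul_cosWave {L a : ℝ} (hL : 0 < L) (ha : 0 < a) (m : ℤ × ℤ) (k : ℤ) :
    ∃ (c d : ℂ) (n l : ℕ), ∀ p : Pt, cosWave L a m k p * (Real.sin (Real.pi * p.2.2 / a) : ℂ) =
      c * scalarMode L a false m n p + d * scalarMode L a false m l p := by
  have hL' : (L : ℂ) ≠ 0 := by exact_mod_cast hL.ne'
  have h2 : Real.sqrt (2 / a) ≠ 0 := (Real.sqrt_pos.2 (by positivity)).ne'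
  have key : ∀ j : ℤ, ∃ d : ℝ, ∀ z : ℝ, Real.sin (j * (Real.pi * z / a)) =
      d * zMode a false j.natAbs z := fun j => by
    rcases Int.natAbs_eq j with h | h
    · refine ⟨(Real.sqrt (2 / a))⁻¹, fun z => ?_⟩
      simp only [zMode, sMode, nu]
      rw [inv_mul_cancel_left₀ h2]
      have : (j : ℝ) = (j.natAbs : ℝ) :=
        (congrArg (Int.cast : ℤ → ℝ) h).trans (Int.cast_natCast _)
      rw [this]
      ring_nf
    · refine ⟨-(Real.sqrt (2 / a))⁻¹, fun z => ?_⟩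
      simp only [zMode, sMode, nu]
      rw [neg_mul, inv_mul_cancel_left₀ h2, ← Real.sin_neg]
      have : (j : ℝ) = -(j.natAbs : ℝ) :=
        (congrArg (Int.cast : ℤ → ℝ) h).trans (by rw [Int.cast_neg, Int.cast_natCast])
      rw [this]
      ring_nf
  obtain ⟨c, hc⟩ := key (k + 1)
  obtain ⟨d, hd⟩ := key (k - 1)
  refine ⟨L * c / 2, -(L * d / 2), (k + 1).natAbs, (k - 1).natAbs, fun p => ?_⟩
  have h1 : Real.cos (k * (Real.pi * p.2.2 / a)) * Real.sin (Real.pi * p.2.2 / a) =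
      (c * zMode a false (k + 1).natAbs p.2.2 - d * zMode a false (k - 1).natAbs p.2.2) / 2 := by
    rw [← hc, ← hd]
    push_cast
    rw [add_mul, sub_mul, one_mul, Real.sin_add, Real.sin_sub]
    ring
  have h1' : (Real.cos (k * (Real.pi * p.2.2 / a)) : ℂ) * (Real.sin (Real.pi * p.2.2 / a) : ℂ) =
      (c * zMode a false (k + 1).natAbs p.2.2 - d * zMode a false (k - 1).natAbs p.2.2) / 2 := by
    exact_mod_cast congrArg (fun t : ℝ => (t : ℂ)) h1
  rw [scalarMode_eq, scalarMode_eq, cosWave, ← Complex.ofReal_cos, mul_assoc, mul_assoc, h1']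
  field_simp
  ring

/-- For sines, `u sin (π z / a)` annihilates every `cosWave`, so it vanishes almost everywhere, and
the factor `sin (π z / a)` is positive on the cell. For cosines, each `cosWave` is a multiple of a
mode. -/
theorem ae_eq_zero_of_integral_scalarMode {L a : ℝ} (hL : 0 < L) (ha : 0 < a) (b : Bool)
    {u : Pt → ℂ} (hu : Integrable u (slabMeasure L a))
    (h0 : ∀ m n, ∫ p, scalarMode L a b m n p * u p ∂(slabMeasure L a) = 0) :
    ∀ᵐ p ∂(slabMeasure L a), u p = 0 := by
  cases b
  · have hs : Continuous fun p : Pt => (Real.sin (Real.pi * p.2.2 / a) : ℂ) := by fun_prop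
    have h := ae_eq_zero_of_integral_cosWave hL ha (integrable_continuous_mul hu hs)
      fun m k => by
        obtain ⟨c, d, n, l, h⟩ := sin_mul_cosWave hL ha m k
        simp only [← mul_assoc, h]
        simp only [add_mul, mul_assoc]
        rw [integral_add
          ((integrable_continuous_mul hu (continuous_scalarMode L a false m n)).const_mul c)
          ((integrable_continuous_mul hu (continuous_scalarMode L a false m l)).const_mul d),
          integral_const_mul, integral_const_mul, h0, h0, mul_zero, mul_zero, add_zero]
    have hc : ∀ᵐ p ∂(slabMeasure L a), p ∈ cell L a := ae_restrict_mem (measurableSet_cell L a)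
    filter_upwards [h, hc] with p hp hpc
    refine (mul_eq_zero.1 hp).resolve_left ?_
    have hpi := Real.pi_pos
    obtain ⟨hz0, hza⟩ := hpc.2.2
    have : 0 < Real.sin (Real.pi * p.2.2 / a) := by
      refine Real.sin_pos_of_pos_of_lt_pi (by positivity) ?_
      rw [div_lt_iff₀ ha]
      exact mul_lt_mul_of_pos_left hza hpi
    exact_mod_cast this.ne'
  · refine ae_eq_zero_of_integral_cosWave hL ha hu fun m k => ?_
    obtain ⟨c, hc⟩ := cosWave_eq_smul_scalarMode hL ha m k
    simp only [hc, mul_assoc]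
    rw [integral_const_mul, h0, mul_zero]

/-! ### Mode expansions in `L²` -/

theorem integrable_component {L a : ℝ} (E : L2Field L a) (i : Fin 3) :
    Integrable (fun p => E p i) (slabMeasure L a) := by
  have h := integrable_inner (continuous_axisField i (continuous_const (y := (1 : ℂ)))) E
  simpa only [inner_axisField, map_one, one_mul] using h

theorem inner_modeField_eq_integral {L a : ℝ} (b : Bool) (i : Fin 3) (m : ℤ × ℤ) (n : ℕ)
    (E : L2Field L a) :
    ⟪modeField L a b i m n, E⟫_ℂ =
      ∫ p, starRingEnd ℂ (scalarMode L a b m n p) * E p i ∂(slabMeasure L a) := by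
  rw [modeField, inner_ofContinuous]
  simp only [inner_axisField]

theorem conj_scalarMode (L a : ℝ) (b : Bool) (m : ℤ × ℤ) (n : ℕ) (p : Pt) :
    starRingEnd ℂ (scalarMode L a b m n p) = scalarMode L a b (-m) n p := by
  rw [scalarMode_eq, scalarMode_eq]
  simp only [map_mul, star_lateralExp, map_inv₀, Complex.conj_ofReal, Prod.fst_neg, Prod.snd_neg]

theorem eq_zero_of_inner_modeField {L a : ℝ} (hL : 0 < L) (ha : 0 < a) (β : Fin 3 → Bool)
    {E : L2Field L a} (h : ∀ i m n, ⟪modeField L a (β i) i m n, E⟫_ℂ = 0) : E = 0 := by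
  have hi : ∀ i, ∀ᵐ p ∂(slabMeasure L a), E p i = 0 := fun i =>
    ae_eq_zero_of_integral_scalarMode hL ha (β i) (integrable_component E i) fun m n => by
      rw [← h i (-m) n, inner_modeField_eq_integral]
      simp only [conj_scalarMode, neg_neg]
  refine Lp.ext ?_
  filter_upwards [hi 0, hi 1, hi 2, Lp.coeFn_zero Vec3 2 (slabMeasure L a)] with p h0 h1 h2 hz
  rw [hz]
  ext i
  fin_cases i
  · exact h0
  · exact h1
  · exact h2

/-- The modes of type `β`: component `i` carries cosines in `z` when `β i = true`, and sines
otherwise. -/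
def basisField (L a : ℝ) (β : Fin 3 → Bool) (q : ((ℤ × ℤ) × ℕ) × Fin 3) : L2Field L a :=
  modeField L a (β q.2) q.2 q.1.1 q.1.2

/-- The indices of nonzero modes of type `β`. -/
def basisIndex (β : Fin 3 → Bool) : Set (((ℤ × ℤ) × ℕ) × Fin 3) :=
  {q | ¬(β q.2 = false ∧ q.1.2 = 0)}

theorem basisField_eq_zero (L a : ℝ) {β : Fin 3 → Bool} {q : ((ℤ × ℤ) × ℕ) × Fin 3}
    (hq : q ∉ basisIndex β) : basisField L a β q = 0 := by
  obtain ⟨⟨m, n⟩, i⟩ := q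
  obtain ⟨h1, h2⟩ := not_not.1 hq
  simp only at h1 h2
  subst h2
  rw [basisField]
  simp only
  rw [h1, modeField_false_zero]

theorem orthonormal_basisField {L a : ℝ} (hL : 0 < L) (ha : 0 < a) (β : Fin 3 → Bool) :
    Orthonormal ℂ fun q : basisIndex β => basisField L a β q := by
  classical
  rw [orthonormal_iff_ite]
  rintro ⟨⟨⟨m, n⟩, i⟩, hq⟩ ⟨⟨⟨m', n'⟩, i'⟩, hq'⟩
  simp only [basisField, Subtype.mk.injEq, Prod.mk.injEq]
  by_cases h : i = i'
  · subst h
    rw [inner_modeField hL ha, zNormSq, if_neg (show ¬(β i = false ∧ n = 0) from hq)]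
    simp
  · rw [inner_modeField_of_ne _ _ h]
    simp [h]

/-- The Hilbert basis of modes of type `β`. -/
def modeBasis {L a : ℝ} (hL : 0 < L) (ha : 0 < a) (β : Fin 3 → Bool) :
    HilbertBasis (basisIndex β) ℂ (L2Field L a) :=
  HilbertBasis.mkOfOrthogonalEqBot (orthonormal_basisField hL ha β) <| by
    rw [Submodule.eq_bot_iff]
    intro E hE
    refine eq_zero_of_inner_modeField hL ha β fun i m n => ?_
    by_cases hq : ((m, n), i) ∈ basisIndex β
    · exact (Submodule.mem_orthogonal _ _).1 hE _ (Submodule.subset_span ⟨⟨_, hq⟩, rfl⟩)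
    · have := basisField_eq_zero L a hq
      rw [basisField] at this
      rw [this, inner_zero_left]

theorem modeBasis_apply {L a : ℝ} (hL : 0 < L) (ha : 0 < a) (β : Fin 3 → Bool)
    (q : basisIndex β) : modeBasis hL ha β q = basisField L a β q := by
  rw [modeBasis, HilbertBasis.coe_mkOfOrthogonalEqBot]

theorem hasSum_basisField {L a : ℝ} (hL : 0 < L) (ha : 0 < a) (β : Fin 3 → Bool)
    (E : L2Field L a) :
    HasSum (fun q => ⟪basisField L a β q, E⟫_ℂ • basisField L a β q) E := by
  have h := (modeBasis hL ha β).hasSum_repr E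
  simp only [HilbertBasis.repr_apply_apply, modeBasis_apply] at h
  refine (Function.Injective.hasSum_iff Subtype.val_injective fun q hq => ?_).1 h
  rw [basisField_eq_zero L a (fun hc => hq ⟨⟨q, hc⟩, rfl⟩), smul_zero]

theorem hasSum_norm_sq_inner_basisField {L a : ℝ} (hL : 0 < L) (ha : 0 < a) (β : Fin 3 → Bool)
    (E : L2Field L a) :
    HasSum (fun q => ‖⟪basisField L a β q, E⟫_ℂ‖ ^ 2) (‖E‖ ^ 2) := by
  have h := (modeBasis hL ha β).hasSum_inner_mul_inner E E
  simp only [modeBasis_apply] at h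
  have e : ∀ x : L2Field L a, ⟪E, x⟫_ℂ * ⟪x, E⟫_ℂ = ((‖⟪x, E⟫_ℂ‖ ^ 2 : ℝ) : ℂ) := fun x => by
    rw [← inner_conj_symm E x, Complex.conj_mul']
    push_cast
    rfl
  simp only [e, inner_self_eq_norm_sq_to_K] at h
  have h' : HasSum (fun q : basisIndex β => ‖⟪basisField L a β q, E⟫_ℂ‖ ^ 2) (‖E‖ ^ 2) := by
    refine Complex.hasSum_ofReal.1 ?_
    rw [Complex.ofReal_pow]
    exact h
  refine (Function.Injective.hasSum_iff Subtype.val_injective fun q hq => ?_).1 h'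
  rw [basisField_eq_zero L a (fun hc => hq ⟨⟨q, hc⟩, rfl⟩), inner_zero_left, norm_zero,
    zero_pow two_ne_zero]

theorem hasSum_fiber_basisField {L a : ℝ} (hL : 0 < L) (ha : 0 < a) (β : Fin 3 → Bool)
    (E : L2Field L a) :
    HasSum (fun j : (ℤ × ℤ) × ℕ => ∑ i, ⟪modeField L a (β i) i j.1 j.2, E⟫_ℂ •
      modeField L a (β i) i j.1 j.2) E :=
  (hasSum_basisField hL ha β E).prod_fiberwise fun _ => hasSum_fintype _

theorem hasSum_fiber_norm_sq {L a : ℝ} (hL : 0 < L) (ha : 0 < a) (β : Fin 3 → Bool)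
    (E : L2Field L a) :
    HasSum (fun j : (ℤ × ℤ) × ℕ => ∑ i, ‖⟪modeField L a (β i) i j.1 j.2, E⟫_ℂ‖ ^ 2)
      (‖E‖ ^ 2) :=
  (hasSum_norm_sq_inner_basisField hL ha β E).prod_fiberwise fun _ => hasSum_fintype _

/-- Riesz–Fischer: the nonzero modes of one component are orthonormal, and the zero modes may carry
arbitrary coefficients. -/
theorem summable_smul_modeField {L a : ℝ} (hL : 0 < L) (ha : 0 < a) (b : Bool) (i : Fin 3)
    {d : (ℤ × ℤ) × ℕ → ℂ} (hd : Summable fun j => ‖d j‖ ^ 2) :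
    Summable fun j => d j • modeField L a b i j.1 j.2 := by
  let s : Set ((ℤ × ℤ) × ℕ) := {j | (j, i) ∈ basisIndex fun _ => b}
  have ho : Orthonormal ℂ fun j : s => modeField L a b i j.1.1 j.1.2 := by
    have h := (orthonormal_basisField hL ha fun _ => b).comp
      (fun j : s => (⟨(j.1, i), j.2⟩ : basisIndex fun _ => b))
      fun j k hjk => Subtype.ext (congrArg (fun q => q.1.1) hjk)
    exact h
  have hs := (ho.orthogonalFamily.summable_iff_norm_sq_summable fun j : s => d j).2
    (hd.comp_injective Subtype.val_injective)
  refine (Function.Injective.summable_iff Subtype.val_injective fun j hj => ?_).1 hs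
  have h0 : modeField L a b i j.1 j.2 = 0 :=
    basisField_eq_zero L a (β := fun _ => b) (q := (j, i)) fun hc => hj ⟨⟨j, hc⟩, rfl⟩
  rw [h0, smul_zero]

/-! ### Integration by parts on the slab -/

instance isFiniteMeasure_slabMeasure (L a : ℝ) : IsFiniteMeasure (slabMeasure L a) :=
  ⟨by
    rw [slabMeasure, Measure.restrict_apply_univ]
    exact (measure_mono (cell_subset_closedCell L a)).trans_lt
      (isCompact_closedCell L a).measure_lt_top⟩

theorem integrable_slab {L a : ℝ} {g : Pt → ℂ} (hg : Continuous g) :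
    Integrable g (slabMeasure L a) := by
  simpa using integrable_continuous_mul (integrable_const (1 : ℂ)) hg

theorem integrable_rectangle {l l' : ℝ} {g : ℝ × ℝ → ℂ} (hg : Continuous g) :
    Integrable g ((volume.restrict (Set.Ioo 0 l)).prod (volume.restrict (Set.Ioo 0 l'))) := by
  rw [Measure.prod_restrict]
  exact (hg.continuousOn.integrableOn_compact (isCompact_Icc.prod isCompact_Icc)).mono_set
    (Set.prod_mono Set.Ioo_subset_Icc_self Set.Ioo_subset_Icc_self)

theorem integral_pd_ex {L a : ℝ} (hL : 0 < L) {g : Pt → ℂ} (hg : ContDiff ℝ ∞ g)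
    (hp : LateralPeriodic L g) : ∫ p, pd ex g p ∂(slabMeasure L a) = 0 := by
  have hi := integrable_slab (L := L) (a := a) (continuous_pd ex hg)
  rw [slabMeasure_eq_prod] at hi ⊢
  rw [integral_prod_symm _ hi]
  refine integral_eq_zero_of_ae (Filter.Eventually.of_forall fun q => ?_)
  obtain ⟨y, z⟩ := q
  refine (setIntegral_Ioo_eq_sub hL (fun x => hasDerivAt_pd_ex hg x y z)
    ((continuous_pd ex hg).comp (by fun_prop))).trans ?_
  have := (hp 0 y z).1
  rw [zero_add] at this
  rw [this, sub_self, Pi.zero_apply]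

theorem integral_pd_ey {L a : ℝ} (hL : 0 < L) {g : Pt → ℂ} (hg : ContDiff ℝ ∞ g)
    (hp : LateralPeriodic L g) : ∫ p, pd ey g p ∂(slabMeasure L a) = 0 := by
  have hi := integrable_slab (L := L) (a := a) (continuous_pd ey hg)
  rw [slabMeasure_eq_prod] at hi ⊢
  rw [integral_prod _ hi]
  refine integral_eq_zero_of_ae (Filter.Eventually.of_forall fun x => ?_)
  refine (integral_prod_symm (fun q : ℝ × ℝ => pd ey g (x, q))
    (integrable_rectangle ((continuous_pd ey hg).comp (by fun_prop)))).trans ?_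
  refine integral_eq_zero_of_ae (Filter.Eventually.of_forall fun z => ?_)
  refine (setIntegral_Ioo_eq_sub hL (fun y => hasDerivAt_pd_ey hg x y z)
    ((continuous_pd ey hg).comp (by fun_prop))).trans ?_
  have := (hp x 0 z).2
  rw [zero_add] at this
  rw [this, sub_self, Pi.zero_apply]

theorem integral_pd_ez {L a : ℝ} (ha : 0 < a) {g : Pt → ℂ} (hg : ContDiff ℝ ∞ g)
    (h0 : ∀ x y, g (x, y, 0) = 0) (h1 : ∀ x y, g (x, y, a) = 0) :
    ∫ p, pd ez g p ∂(slabMeasure L a) = 0 := by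
  have hi := integrable_slab (L := L) (a := a) (continuous_pd ez hg)
  rw [slabMeasure_eq_prod] at hi ⊢
  rw [integral_prod _ hi]
  refine integral_eq_zero_of_ae (Filter.Eventually.of_forall fun x => ?_)
  refine (integral_prod (fun q : ℝ × ℝ => pd ez g (x, q))
    (integrable_rectangle ((continuous_pd ez hg).comp (by fun_prop)))).trans ?_
  refine integral_eq_zero_of_ae (Filter.Eventually.of_forall fun y => ?_)
  refine (setIntegral_Ioo_eq_sub ha (fun z => hasDerivAt_pd_ez hg x y z)
    ((continuous_pd ez hg).comp (by fun_prop))).trans ?_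
  rw [h0, h1, sub_self, Pi.zero_apply]

theorem pd_mul (v : Pt) {f g : Pt → ℂ} (hf : ContDiff ℝ ∞ f) (hg : ContDiff ℝ ∞ g) (p : Pt) :
    pd v (fun q => f q * g q) p = pd v f p * g p + f p * pd v g p := by
  have h1 : DifferentiableAt ℝ f p := hf.contDiffAt.differentiableAt (by simp)
  have h2 : DifferentiableAt ℝ g p := hg.contDiffAt.differentiableAt (by simp)
  simp only [pd, fderiv_fun_mul h1 h2, add_apply, smul_apply, smul_eq_mul]
  ring

theorem pd_sub (v : Pt) {f g : Pt → ℂ} (hf : ContDiff ℝ ∞ f) (hg : ContDiff ℝ ∞ g) (p : Pt) :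
    pd v (fun q => f q - g q) p = pd v f p - pd v g p := by
  have h1 : DifferentiableAt ℝ f p := hf.contDiffAt.differentiableAt (by simp)
  have h2 : DifferentiableAt ℝ g p := hg.contDiffAt.differentiableAt (by simp)
  simp [pd, fderiv_fun_sub h1 h2]

theorem contDiff_conj {f : Pt → ℂ} (hf : ContDiff ℝ ∞ f) :
    ContDiff ℝ ∞ fun p => starRingEnd ℂ (f p) :=
  Complex.conjCLE.contDiff.comp hf

theorem pd_conj (v : Pt) {f : Pt → ℂ} (hf : ContDiff ℝ ∞ f) (p : Pt) :
    pd v (fun q => starRingEnd ℂ (f q)) p = starRingEnd ℂ (pd v f p) := by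
  have h1 : HasFDerivAt f (fderiv ℝ f p) p :=
    (hf.contDiffAt.differentiableAt (by simp)).hasFDerivAt
  have h2 := (Complex.conjCLE.hasFDerivAt (x := f p)).comp p h1
  exact congrArg (fun T => T v) h2.fderiv

theorem vec3_inner (v w : Vec3) :
    ⟪v, w⟫_ℂ = starRingEnd ℂ (v 0) * w 0 + starRingEnd ℂ (v 1) * w 1 +
      starRingEnd ℂ (v 2) * w 2 := by
  rw [PiLp.inner_apply, Fin.sum_univ_three]
  simp only [RCLike.inner_apply]
  ring

theorem integral_add_add {L a : ℝ} {f g h : Pt → ℂ} (hf : Integrable f (slabMeasure L a))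
    (hg : Integrable g (slabMeasure L a)) (hh : Integrable h (slabMeasure L a)) :
    ∫ p, (f p + g p + h p) ∂(slabMeasure L a) = ∫ p, f p ∂(slabMeasure L a) +
      ∫ p, g p ∂(slabMeasure L a) + ∫ p, h p ∂(slabMeasure L a) := by
  rw [← integral_add hf hg]
  exact integral_add (hf.add hg) hh

/-- The difference of the integrands is the divergence of `conj ψ × F`. Lateral fluxes cancel by
periodicity, and the flux through the plates involves only tangential components of `F`, which
vanish there. Hence `ψ` is unrestricted at the plates. -/
theorem integral_inner_curl_left {L a : ℝ} (hL : 0 < L) (ha : 0 < a) {ψ F : Pt → Vec3}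
    (hψ : ContDiff ℝ ∞ ψ) (hψp : LateralPeriodic L ψ) (hF : IsSmoothPEC L a F) :
    ∫ p, ⟪curl ψ p, F p⟫_ℂ ∂(slabMeasure L a) = ∫ p, ⟪ψ p, curl F p⟫_ℂ ∂(slabMeasure L a) := by
  have hP : ∀ i, ContDiff ℝ ∞ fun p => starRingEnd ℂ (ψ p i) := fun i =>
    contDiff_conj (contDiff_comp hψ i)
  have hF' : ∀ i, ContDiff ℝ ∞ fun p => F p i := fun i => contDiff_comp hF.smooth i
  have hm : ∀ i j, ContDiff ℝ ∞ fun p => starRingEnd ℂ (ψ p i) * F p j := fun i j =>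
    (hP i).mul (hF' j)
  have hc : ∀ i j, ContDiff ℝ ∞ fun p => starRingEnd ℂ (ψ p i) * F p j -
      starRingEnd ℂ (ψ p j) * F p i := fun i j => (hm i j).sub (hm j i)
  have hper : ∀ i j, LateralPeriodic L fun p => starRingEnd ℂ (ψ p i) * F p j -
      starRingEnd ℂ (ψ p j) * F p i := fun i j x y z => by
    simp only [(hψp x y z).1, (hψp x y z).2, (hF.periodic x y z).1, (hF.periodic x y z).2,
      and_self]
  have i0 := integral_pd_ex (a := a) hL (hc 1 2) (hper 1 2)
  have i1 := integral_pd_ey (a := a) hL (hc 2 0) (hper 2 0)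
  have i2 := integral_pd_ez (L := L) ha (hc 0 1)
    (fun x y => by simp [(hF.bottom x y).1, (hF.bottom x y).2])
    (fun x y => by simp [(hF.top x y).1, (hF.top x y).2])
  have hi : ∀ {v : Pt} {g : Pt → ℂ}, ContDiff ℝ ∞ g → Integrable (pd v g) (slabMeasure L a) :=
    fun hg => integrable_slab (continuous_pd _ hg)
  have hint : ∀ {G H : Pt → Vec3}, Continuous G → Continuous H →
      Integrable (fun p => ⟪G p, H p⟫_ℂ) (slabMeasure L a) := fun hG hH =>
    integrable_slab (hG.inner hH)
  rw [← sub_eq_zero, ← integral_sub (hint (continuous_curl hψ) hF.smooth.continuous)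
    (hint hψ.continuous (continuous_curl hF.smooth))]
  have e : ∀ p, ⟪curl ψ p, F p⟫_ℂ - ⟪ψ p, curl F p⟫_ℂ =
      pd ex (fun p => starRingEnd ℂ (ψ p 1) * F p 2 - starRingEnd ℂ (ψ p 2) * F p 1) p +
      pd ey (fun p => starRingEnd ℂ (ψ p 2) * F p 0 - starRingEnd ℂ (ψ p 0) * F p 2) p +
      pd ez (fun p => starRingEnd ℂ (ψ p 0) * F p 1 - starRingEnd ℂ (ψ p 1) * F p 0) p :=
    fun p => by
      simp only [pd_sub _ (hm _ _) (hm _ _), pd_mul _ (hP _) (hF' _),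
        pd_conj _ (contDiff_comp hψ _), vec3_inner]
      simp [curl]
      ring
  simp only [e]
  rw [integral_add_add (hi (hc 1 2)) (hi (hc 2 0)) (hi (hc 0 1)), i0, i1, i2, add_zero, add_zero]

/-- The coordinate directions. -/
def axis : Fin 3 → Pt := ![ex, ey, ez]

theorem grad_apply (f : Pt → ℂ) (p : Pt) (i : Fin 3) : grad f p i = pd (axis i) f p := by
  fin_cases i <;> rfl

theorem IsTest.apply_zero {X : Type} [NormedAddCommGroup X] [NormedSpace ℝ X] {L a : ℝ}
    {f : Pt → X} (hf : IsTest L a f) (x y : ℝ) : f (x, y, 0) = 0 := by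
  obtain ⟨α, β, hα, hβ, h⟩ := hf.support
  by_contra hc
  exact absurd (h x y 0 hc).1 (not_le.2 hα)

theorem IsTest.apply_top {X : Type} [NormedAddCommGroup X] [NormedSpace ℝ X] {L a : ℝ}
    {f : Pt → X} (hf : IsTest L a f) (x y : ℝ) : f (x, y, a) = 0 := by
  obtain ⟨α, β, hα, hβ, h⟩ := hf.support
  by_contra hc
  exact absurd (h x y a hc).2 (not_le.2 hβ)

/-- Here the test function `f` removes the boundary term, so `g` may be a cosine mode. -/
theorem integral_conj_pd_mul {L a : ℝ} (hL : 0 < L) (ha : 0 < a) {f g : Pt → ℂ}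
    (hf : IsTest L a f) (hg : ContDiff ℝ ∞ g) (hgp : LateralPeriodic L g) (i : Fin 3) :
    ∫ p, starRingEnd ℂ (pd (axis i) f p) * g p ∂(slabMeasure L a) =
      -∫ p, starRingEnd ℂ (f p) * pd (axis i) g p ∂(slabMeasure L a) := by
  have hfc := contDiff_conj hf.smooth
  have hm := hfc.mul hg
  have hper : LateralPeriodic L fun p => starRingEnd ℂ (f p) * g p := fun x y z => by
    simp only [(hf.periodic x y z).1, (hf.periodic x y z).2, (hgp x y z).1, (hgp x y z).2,
      and_self]
  have h0 : ∫ p, pd (axis i) (fun p => starRingEnd ℂ (f p) * g p) p ∂(slabMeasure L a) = 0 := by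
    fin_cases i
    · exact integral_pd_ex hL hm hper
    · exact integral_pd_ey hL hm hper
    · exact integral_pd_ez ha hm (fun x y => by simp [hf.apply_zero])
        (fun x y => by simp [hf.apply_top])
  simp only [pd_mul _ hfc hg, pd_conj _ hf.smooth] at h0
  have h1 : Integrable (fun p => starRingEnd ℂ (pd (axis i) f p) * g p) (slabMeasure L a) :=
    integrable_slab ((Complex.continuous_conj.comp (continuous_pd _ hf.smooth)).mul hg.continuous)
  have h2 : Integrable (fun p => starRingEnd ℂ (f p) * pd (axis i) g p) (slabMeasure L a) :=
    integrable_slab (hfc.continuous.mul (continuous_pd _ hg))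
  rw [integral_add h1 h2] at h0
  exact eq_neg_of_add_eq_zero_left h0

/-! ### Cutoffs in the plate variable -/

/-- A smooth step from `0` on `(-∞, 1]` to `1` on `[2, ∞)`. -/
def step (t : ℝ) : ℝ := Real.smoothTransition (t - 1)

theorem contDiff_step : ContDiff ℝ ∞ step :=
  Real.smoothTransition.contDiff.comp (contDiff_id.sub contDiff_const)

theorem step_of_two_le {t : ℝ} (h : 2 ≤ t) : step t = 1 :=
  Real.smoothTransition.one_of_one_le (by linarith)

theorem step_of_le_one {t : ℝ} (h : t ≤ 1) : step t = 0 :=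
  Real.smoothTransition.zero_of_nonpos (by linarith)

theorem abs_step_le_one (t : ℝ) : |step t| ≤ 1 := by
  rw [step, abs_of_nonneg (Real.smoothTransition.nonneg _)]
  exact Real.smoothTransition.le_one _

theorem deriv_step_of_two_lt {t : ℝ} (h : 2 < t) : deriv step t = 0 := by
  have : step =ᶠ[𝓝 t] fun _ => (1 : ℝ) := by
    filter_upwards [lt_mem_nhds h] with s hs
    exact step_of_two_le hs.le
  rw [this.deriv_eq, deriv_const]

theorem deriv_step_of_lt_one {t : ℝ} (h : t < 1) : deriv step t = 0 := by
  have : step =ᶠ[𝓝 t] fun _ => (0 : ℝ) := by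
    filter_upwards [gt_mem_nhds h] with s hs
    exact step_of_le_one hs.le
  rw [this.deriv_eq, deriv_const]

/-- The derivative of `step` lives on `[1, 2]`. The product with `t` is the scale-invariant
quantity, so the bound survives the rescaling by `k + 1` in `cutoff`. -/
theorem exists_abs_deriv_step_mul_le : ∃ M : ℝ, 0 ≤ M ∧ ∀ t, |deriv step t * t| ≤ M := by
  have hc : Continuous fun t => deriv step t * t :=
    (contDiff_step.continuous_deriv (by simp)).mul continuous_id
  obtain ⟨C, hC⟩ := (isCompact_Icc (a := (1 : ℝ)) (b := 2)).exists_bound_of_continuousOn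
    hc.continuousOn
  refine ⟨max C 0, le_max_right _ _, fun t => ?_⟩
  rcases lt_or_ge t 1 with h | h
  · rw [deriv_step_of_lt_one h, zero_mul, abs_zero]
    exact le_max_right _ _
  rcases lt_or_ge 2 t with h' | h'
  · rw [deriv_step_of_two_lt h', zero_mul, abs_zero]
    exact le_max_right _ _
  · exact (hC t ⟨h, h'⟩).trans (le_max_left _ _)

/-- A cutoff supported away from the plates at distance `1 / (k + 1)`. -/
def cutoff (a : ℝ) (k : ℕ) (z : ℝ) : ℝ := step ((k + 1) * z) * step ((k + 1) * (a - z))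

theorem contDiff_cutoff (a : ℝ) (k : ℕ) : ContDiff ℝ ∞ (cutoff a k) :=
  (contDiff_step.comp (contDiff_const.mul contDiff_id)).mul
    (contDiff_step.comp (contDiff_const.mul (contDiff_const.sub contDiff_id)))

theorem abs_cutoff_le_one (a : ℝ) (k : ℕ) (z : ℝ) : |cutoff a k z| ≤ 1 := by
  rw [cutoff, abs_mul]
  exact mul_le_one₀ (abs_step_le_one _) (abs_nonneg _) (abs_step_le_one _)

theorem cutoff_support (a : ℝ) (k : ℕ) (z : ℝ) (h : cutoff a k z ≠ 0) :
    1 / ((k : ℝ) + 1) ≤ z ∧ z ≤ a - 1 / ((k : ℝ) + 1) := by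
  have hk : (0 : ℝ) < k + 1 := by positivity
  have h1 : 1 < (k + 1) * z := by
    by_contra! hc
    exact h (by rw [cutoff, step_of_le_one hc, zero_mul])
  have h2 : 1 < (k + 1) * (a - z) := by
    by_contra! hc
    exact h (by rw [cutoff, step_of_le_one hc, mul_zero])
  constructor
  · rw [div_le_iff₀ hk]
    linarith
  · have : 1 / ((k : ℝ) + 1) ≤ a - z := by
      rw [div_le_iff₀ hk]
      linarith
    linarith

theorem hasDerivAt_cutoff (a : ℝ) (k : ℕ) (z : ℝ) :
    HasDerivAt (cutoff a k)
      ((k + 1) * deriv step ((k + 1) * z) * step ((k + 1) * (a - z)) -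
        step ((k + 1) * z) * ((k + 1) * deriv step ((k + 1) * (a - z)))) z := by
  have hs : ∀ t, HasDerivAt step (deriv step t) t := fun t =>
    (contDiff_step.differentiable (by simp)).differentiableAt.hasDerivAt
  have h1 : HasDerivAt (fun z : ℝ => ((k : ℝ) + 1) * z) (k + 1) z := by
    simpa using (hasDerivAt_id z).const_mul ((k : ℝ) + 1)
  have h2 : HasDerivAt (fun z : ℝ => ((k : ℝ) + 1) * (a - z)) (-(k + 1)) z := by
    simpa using ((hasDerivAt_id z).const_sub a).const_mul ((k : ℝ) + 1)
  refine (((hs _).comp z h1).mul ((hs _).comp z h2)).congr_deriv ?_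
  simp only [Function.comp_apply]
  ring

theorem eventually_cutoff (a : ℝ) {z : ℝ} (hz : z ∈ Set.Ioo 0 a) :
    ∀ᶠ k : ℕ in atTop, cutoff a k z = 1 ∧ deriv (cutoff a k) z = 0 := by
  have key : ∀ {t : ℝ}, 0 < t → ∀ᶠ k : ℕ in atTop, 2 < ((k : ℝ) + 1) * t := fun ht =>
    ((tendsto_natCast_atTop_atTop.atTop_add tendsto_const_nhds).atTop_mul_const
      ht).eventually_gt_atTop 2
  filter_upwards [key hz.1, key (sub_pos.2 hz.2)] with k h1 h2
  constructor
  · rw [cutoff, step_of_two_le h1.le, step_of_two_le h2.le, one_mul]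
  · rw [(hasDerivAt_cutoff a k z).deriv, deriv_step_of_two_lt h1, deriv_step_of_two_lt h2]
    simp

/-- The derivative of the cutoff grows like `k + 1` but only at distance of order `1 / (k + 1)` from
a plate. A quantity bounded linearly by the distance to both plates compensates this uniformly in
`k`. -/
theorem exists_deriv_cutoff_bound (a : ℝ) : ∃ M : ℝ, 0 ≤ M ∧ ∀ (k : ℕ) (z s D : ℝ),
    z ∈ Set.Ioo 0 a → |s| ≤ D * z → |s| ≤ D * (a - z) → |deriv (cutoff a k) z * s| ≤ M * D := by
  obtain ⟨M, hM0, hM⟩ := exists_abs_deriv_step_mul_le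
  have key : ∀ (c t s D : ℝ), 0 < c → 0 < t → |s| ≤ D * t →
      |c * deriv step (c * t)| * |s| ≤ M * D := fun c t s D hc ht hs => by
    have hD : 0 ≤ D := by
      by_contra! h
      nlinarith [abs_nonneg s]
    calc |c * deriv step (c * t)| * |s| ≤ |c * deriv step (c * t)| * (D * t) := by gcongr
      _ = |deriv step (c * t) * (c * t)| * D := by
          rw [abs_mul, abs_mul, abs_mul, abs_of_pos ht]; ring
      _ ≤ M * D := by gcongr; exact hM _
  -- One `M` for each of the two plates.
  refine ⟨2 * M, by positivity, fun k z s D hz h1 h2 => ?_⟩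
  have hk : (0 : ℝ) < k + 1 := by positivity
  have e1 := key (k + 1) z s D hk hz.1 h1
  have e2 := key (k + 1) (a - z) s D hk (sub_pos.2 hz.2) h2
  rw [(hasDerivAt_cutoff a k z).deriv, sub_mul]
  refine (abs_sub _ _).trans ?_
  have f1 : |(k + 1) * deriv step ((k + 1) * z) * step ((k + 1) * (a - z)) * s| ≤ M * D := by
    rw [abs_mul, abs_mul _ (step _)]
    refine le_trans ?_ e1
    gcongr
    exact mul_le_of_le_one_right (abs_nonneg _) (abs_step_le_one _)
  have f2 : |step ((k + 1) * z) * ((k + 1) * deriv step ((k + 1) * (a - z))) * s| ≤ M * D := by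
    rw [abs_mul, abs_mul (step _)]
    refine le_trans ?_ e2
    gcongr
    exact mul_le_of_le_one_left (abs_nonneg _) (abs_step_le_one _)
  linarith

/-- A function cut off near the plates. -/
def cutFun {X : Type} [NormedAddCommGroup X] [NormedSpace ℝ X] (a : ℝ) (k : ℕ) (g : Pt → X)
    (p : Pt) : X := cutoff a k p.2.2 • g p

theorem isTest_cutFun {X : Type} [NormedAddCommGroup X] [NormedSpace ℝ X] {L : ℝ} (a : ℝ)
    (k : ℕ) {g : Pt → X} (hg : ContDiff ℝ ∞ g) (hp : LateralPeriodic L g) :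
    IsTest L a (cutFun a k g) where
  smooth := ((contDiff_cutoff a k).comp (contDiff_snd.comp contDiff_snd)).smul hg
  periodic := fun x y z => by simp only [cutFun, (hp x y z).1, (hp x y z).2, and_self]
  support := ⟨1 / ((k : ℝ) + 1), a - 1 / ((k : ℝ) + 1), by positivity,
    sub_lt_self _ (by positivity), fun x y z h =>
      cutoff_support a k z fun hc => h (by simp only [cutFun, hc, zero_smul])⟩

theorem tendsto_cutFun {X : Type} [NormedAddCommGroup X] [NormedSpace ℝ X] {L a : ℝ}
    (g : Pt → X) {p : Pt} (hp : p ∈ cell L a) :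
    Tendsto (fun k => cutFun a k g p) atTop (𝓝 (g p)) := by
  refine tendsto_const_nhds.congr' ?_
  filter_upwards [eventually_cutoff a hp.2.2] with k hk
  rw [cutFun, hk.1, one_smul]

/-! ### Removing the cutoff from pairings with `L²` fields. -/

theorem eventually_mem_cell (L a : ℝ) : ∀ᵐ p ∂(slabMeasure L a), p ∈ cell L a :=
  ae_restrict_mem (measurableSet_cell L a)

theorem integrable_norm_field {L a : ℝ} (E : L2Field L a) :
    Integrable (fun p => ‖E p‖) (slabMeasure L a) :=
  ((Lp.memLp E).integrable one_le_two).norm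

theorem tendsto_integral_inner {L a : ℝ} (E : L2Field L a) {F : ℕ → Pt → Vec3} {G : Pt → Vec3}
    (hF : ∀ k, Continuous (F k)) (C : ℝ) (hb : ∀ k, ∀ p ∈ cell L a, ‖F k p‖ ≤ C)
    (hlim : ∀ p ∈ cell L a, Tendsto (fun k => F k p) atTop (𝓝 (G p))) :
    Tendsto (fun k => ∫ p, ⟪F k p, E p⟫_ℂ ∂(slabMeasure L a)) atTop
      (𝓝 (∫ p, ⟪G p, E p⟫_ℂ ∂(slabMeasure L a))) := by
  refine tendsto_integral_of_dominated_convergence (fun p => C * ‖E p‖)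
    (fun k => (integrable_inner (hF k) E).aestronglyMeasurable)
    ((integrable_norm_field E).const_mul C) (fun k => ?_) ?_
  · filter_upwards [eventually_mem_cell L a] with p hp
    exact (norm_inner_le_norm _ _).trans
      (mul_le_mul_of_nonneg_right (hb k p hp) (norm_nonneg _))
  · filter_upwards [eventually_mem_cell L a] with p hp
    exact (hlim p hp).inner tendsto_const_nhds

theorem exists_norm_le_on_cell {L a : ℝ} {G : Pt → Vec3} (hG : Continuous G) :
    ∃ C, ∀ p ∈ cell L a, ‖G p‖ ≤ C := by
  obtain ⟨C, hC⟩ := (isCompact_closedCell L a).exists_bound_of_continuousOn hG.continuousOn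
  exact ⟨C, fun p hp => hC p (cell_subset_closedCell L a hp)⟩

/-- A field that annihilates all test fields vanishes. -/
theorem eq_zero_of_integral_isTest {L a : ℝ} (hL : 0 < L) (ha : 0 < a) {E : L2Field L a}
    (h : ∀ ψ : Pt → Vec3, IsTest L a ψ → ∫ p, ⟪ψ p, E p⟫_ℂ ∂(slabMeasure L a) = 0) : E = 0 := by
  refine eq_zero_of_inner_modeField hL ha (fun _ => true) fun i m n => ?_
  have hs := contDiff_axisField i (contDiff_scalarMode L a true m n)
  have hp := periodic_axisField i (periodic_scalarMode hL a true m n)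
  obtain ⟨C, hC⟩ := exists_norm_le_on_cell (L := L) (a := a) hs.continuous
  rw [modeField, inner_ofContinuous]
  have ht := tendsto_integral_inner E (G := axisField i (scalarMode L a true m n))
    (fun k => (isTest_cutFun a k hs hp).smooth.continuous) C
    (fun k p hpc => by
      rw [cutFun, norm_smul, Real.norm_eq_abs]
      exact (mul_le_of_le_one_left (norm_nonneg _) (abs_cutoff_le_one _ _ _)).trans (hC p hpc))
    (fun p hpc => tendsto_cutFun _ hpc)
  simp only [h _ (isTest_cutFun a _ hs hp)] at ht
  exact tendsto_nhds_unique ht tendsto_const_nhds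

/-- Identifies any given weak curl with the one that accompanies `E` in the closure of the smooth
pairs. -/
theorem HasWeakCurl.unique {L a : ℝ} (hL : 0 < L) (ha : 0 < a) {E G G' : L2Field L a}
    (h : HasWeakCurl E G) (h' : HasWeakCurl E G') : G = G' := by
  have hd : HasWeakCurl (E + (-1 : ℂ) • E) (G + (-1 : ℂ) • G') := h.add (h'.smul (-1))
  have e1 : E + (-1 : ℂ) • E = 0 := by rw [neg_one_smul, add_neg_cancel]
  rw [e1] at hd
  have := eq_zero_of_integral_isTest hL ha fun ψ hψ => by
    rw [← hd ψ hψ, integral_inner_zero]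
  rwa [neg_one_smul, ← sub_eq_add_neg, sub_eq_zero] at this

/-- Uses `|sin t| ≤ |t|` at `z` and, by the symmetry `sin (n π - t) = ± sin t`, at `a - z`. These
are the linear bounds that `exists_deriv_cutoff_bound` requires. -/
theorem abs_sMode_le {a : ℝ} (ha : 0 < a) (n : ℕ) {z : ℝ} (hz : z ∈ Set.Ioo 0 a) :
    |sMode a n z| ≤ Real.sqrt (2 / a) * nu a n * z ∧
      |sMode a n z| ≤ Real.sqrt (2 / a) * nu a n * (a - z) := by
  have hν := nu_nonneg ha n
  have h0 : ∀ t, 0 ≤ t → |Real.sin (nu a n * t)| ≤ nu a n * t := fun t ht =>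
    (Real.abs_sin_le_abs).trans (abs_of_nonneg (mul_nonneg hν ht)).le
  have hna : nu a n * z = n * Real.pi - nu a n * (a - z) := by
    unfold nu
    field_simp
    ring
  have hsym : |Real.sin (nu a n * z)| = |Real.sin (nu a n * (a - z))| := by
    rw [hna, Real.sin_nat_mul_pi_sub, abs_neg, abs_mul]
    simp
  rw [sMode, abs_mul, abs_of_nonneg (Real.sqrt_nonneg _), mul_assoc, mul_assoc]
  constructor
  · gcongr
    exact h0 z hz.1.le
  · rw [hsym]
    gcongr
    exact h0 _ (sub_pos.2 hz.2).le

theorem grad_cutFun {a : ℝ} (k : ℕ) {g : Pt → ℂ} (hg : ContDiff ℝ ∞ g) (p : Pt) :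
    grad (cutFun a k g) p = cutoff a k p.2.2 • grad g p +
      axisField 2 (fun q => ((deriv (cutoff a k) q.2.2 : ℝ) : ℂ) * g q) p := by
  have hc : ContDiff ℝ ∞ fun q : Pt => (cutoff a k q.2.2 : ℂ) :=
    Complex.ofRealCLM.contDiff.comp ((contDiff_cutoff a k).comp (contDiff_snd.comp contDiff_snd))
  have e : cutFun a k g = fun q => (cutoff a k q.2.2 : ℂ) * g q := by
    funext q
    rw [cutFun, Complex.real_smul]
  obtain ⟨x, y, z⟩ := p
  have hx := (hasDerivAt_pd_ex hc x y z).unique (hasDerivAt_const x (cutoff a k z : ℂ))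
  have hy := (hasDerivAt_pd_ey hc x y z).unique (hasDerivAt_const y (cutoff a k z : ℂ))
  have hz := (hasDerivAt_pd_ez hc x y z).unique
    ((contDiff_cutoff a k).differentiable (by simp)).differentiableAt.hasDerivAt.ofReal_comp
  rw [e]
  ext i
  fin_cases i
  · simp [grad, axisField, pd_mul _ hc hg, hx]
  · simp [grad, axisField, pd_mul _ hc hg, hy]
  · simp [grad, axisField, pd_mul _ hc hg, hz]
    ring

theorem norm_phi {L : ℝ} (hL : 0 < L) (m : ℤ × ℤ) (x y : ℝ) : ‖phi L m x y‖ = L⁻¹ := by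
  rw [phi, norm_mul, Complex.norm_exp_I_mul_ofReal, mul_one, norm_inv, Complex.norm_real,
    Real.norm_eq_abs, abs_of_pos hL]

/-- Divergence-free fields are orthogonal to the gradients of `φ_m s_n`. -/
theorem integral_inner_grad_scalarMode {L a : ℝ} (hL : 0 < L) (ha : 0 < a) {E : L2Field L a}
    (hE : E ∈ divFree L a) (m : ℤ × ℤ) (n : ℕ) :
    ∫ p, ⟪grad (scalarMode L a false m n) p, E p⟫_ℂ ∂(slabMeasure L a) = 0 := by
  have hs := contDiff_scalarMode L a false m n
  have hp := periodic_scalarMode hL a false m n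
  obtain ⟨C, hC⟩ := exists_norm_le_on_cell (L := L) (a := a) (continuous_grad hs)
  obtain ⟨M, hM0, hM⟩ := exists_deriv_cutoff_bound a
  have ht := tendsto_integral_inner E (G := grad (scalarMode L a false m n))
    (fun k => continuous_grad (isTest_cutFun a k hs hp).smooth)
    -- The dominating constant: `C` bounds the cutoff times the gradient. The other term bounds the
    -- derivative of the cutoff times `φ_m s_n`, where `L⁻¹` is the modulus of `φ_m`.
    (C + L⁻¹ * (M * (Real.sqrt (2 / a) * nu a n)))
    (fun k p hpc => by
      rw [grad_cutFun k hs]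
      refine (norm_add_le _ _).trans (add_le_add ?_ ?_)
      · rw [norm_smul, Real.norm_eq_abs]
        exact (mul_le_of_le_one_left (norm_nonneg _) (abs_cutoff_le_one _ _ _)).trans (hC p hpc)
      · obtain ⟨h1, h2⟩ := abs_sMode_le ha n hpc.2.2
        have := hM k p.2.2 _ _ hpc.2.2 h1 h2
        rw [axisField, PiLp.norm_single, scalarMode, norm_mul, norm_mul, norm_phi hL,
          Complex.norm_real, Complex.norm_real, mul_left_comm, ← norm_mul]
        exact mul_le_mul_of_nonneg_left this (inv_nonneg.2 hL.le))
    (fun p hpc => by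
      refine tendsto_const_nhds.congr' ?_
      filter_upwards [eventually_cutoff a hpc.2.2] with k hk
      rw [grad_cutFun k hs, axisField, hk.1, hk.2, one_smul, Complex.ofReal_zero, zero_mul]
      simp)
  simp only [hE _ (isTest_cutFun a _ hs hp)] at ht
  exact tendsto_nhds_unique ht tendsto_const_nhds

/-! ### The curl on modes -/

/-- The mode type `(b, b, !b)`: electric fields expand in type `false` and their curls in type
`true`. -/
def fieldType (b : Bool) : Fin 3 → Bool := ![b, b, !b]

/-- The coefficient of the `k`-th component of the curl of the mode with component `i`. -/
def curlCoeff (L a : ℝ) (b : Bool) (m : ℤ × ℤ) (n : ℕ) : Fin 3 → Fin 3 → ℂ :=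
  ![![0, zSign b * nu a n, -(Complex.I * ky L m)],
    ![-(zSign b * nu a n), 0, Complex.I * kx L m],
    ![Complex.I * ky L m, -(Complex.I * kx L m), 0]]

theorem ofContinuous_eq_sum {L a : ℝ} (β : Fin 3 → Bool) (c : Fin 3 → ℂ) (m : ℤ × ℤ) (n : ℕ)
    {F : Pt → Vec3} (hF : Continuous F)
    (h : ∀ p i, F p i = c i * scalarMode L a (β i) m n p) :
    ofContinuous L a F hF = ∑ i, c i • modeField L a (β i) i m n := by
  have hm : ∀ i, Continuous (axisField i (scalarMode L a (β i) m n)) := fun i =>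
    continuous_axisField i (continuous_scalarMode L a (β i) m n)
  have hc : ∀ i, Continuous fun p => c i • axisField i (scalarMode L a (β i) m n) p := fun i =>
    (hm i).const_smul (c i)
  have e : ∀ i, ofContinuous L a _ (hc i) = c i • modeField L a (β i) i m n := fun i =>
    ofContinuous_smul L a (c i) (hm i) (hc i) fun _ => rfl
  rw [Fin.sum_univ_three, ← e, ← e, ← e,
    ← ofContinuous_add L a (hc 0) (hc 1) ((hc 0).add (hc 1)) fun _ => rfl]
  refine ofContinuous_add L a ((hc 0).add (hc 1)) (hc 2) hF fun p => ?_
  ext i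
  rw [h]
  fin_cases i <;> simp [axisField]

/-- The types match because `∂_z` exchanges sines and cosines and appears only between the two
tangential components. Lateral derivatives keep the `z`-factor and either join a tangential
component to the normal one or the reverse. -/
theorem curl_axisField_scalarMode (L a : ℝ) (b : Bool) (i : Fin 3) (m : ℤ × ℤ) (n : ℕ) (p : Pt)
    (k : Fin 3) :
    curl (axisField i (scalarMode L a (fieldType b i) m n)) p k =
      curlCoeff L a b m n i k * scalarMode L a (fieldType (!b) k) m n p := by
  have h0 : ∀ v, pd v (fun _ => (0 : ℂ)) p = 0 := fun v => by simp [pd]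
  have hx := fun b => pd_ex_scalarMode L a b m n p
  have hy := fun b => pd_ey_scalarMode L a b m n p
  have hz := fun b => pd_ez_scalarMode L a b m n p
  fin_cases i <;> fin_cases k <;>
    simp [curl, axisField, fieldType, curlCoeff, h0, hx, hy, hz]

theorem ofContinuous_curl_mode (L a : ℝ) (b : Bool) (i : Fin 3) (m : ℤ × ℤ) (n : ℕ) :
    ofContinuous L a (curl (axisField i (scalarMode L a (fieldType b i) m n)))
      (continuous_curl (contDiff_axisField i (contDiff_scalarMode L a _ m n))) =
      ∑ k, curlCoeff L a b m n i k • modeField L a (fieldType (!b) k) k m n :=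
  ofContinuous_eq_sum _ _ m n _ fun p k => curl_axisField_scalarMode L a b i m n p k

theorem norm_sq_curlCoeff_le (L a : ℝ) (b : Bool) (m : ℤ × ℤ) (n : ℕ) (i k : Fin 3) :
    ‖curlCoeff L a b m n i k‖ ^ 2 ≤ lam L a m n := by
  have hx := sq_nonneg (kx L m)
  have hy := sq_nonneg (ky L m)
  have hz := sq_nonneg (nu a n)
  have hs : |zSign b| = 1 := by cases b <;> simp [zSign]
  unfold lam kSq
  fin_cases i <;> fin_cases k <;> simp [curlCoeff, hs] <;> linarith

/-! ### Fields in the closure of the smooth perfect-conductor fields -/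

theorem isSmoothPEC_mode {L a : ℝ} (hL : 0 < L) (ha : 0 < a) (i : Fin 3) (m : ℤ × ℤ) (n : ℕ) :
    IsSmoothPEC L a (axisField i (scalarMode L a (fieldType false i) m n)) where
  smooth := contDiff_axisField i (contDiff_scalarMode L a _ m n)
  periodic := periodic_axisField i (periodic_scalarMode hL a _ m n)
  bottom := fun x y => by
    fin_cases i <;> simp [axisField, fieldType, scalarMode, zMode_false_left]
  top := fun x y => by
    fin_cases i <;> simp [axisField, fieldType, scalarMode, zMode_false_right ha]

/-- Both sides are continuous in `(E, G)` and agree on smooth perfect-conductor pairs. Since `ψ`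
need not vanish at the plates, this retains the boundary condition in the limit, unlike
`HasWeakCurl`. -/
theorem inner_curl_of_mem_closure {L a : ℝ} (hL : 0 < L) (ha : 0 < a) {E G : L2Field L a}
    (h : (E, G) ∈ (smoothPECGraph L a).topologicalClosure) {ψ : Pt → Vec3}
    (hψ : ContDiff ℝ ∞ ψ) (hp : LateralPeriodic L ψ) :
    ⟪ofContinuous L a (curl ψ) (continuous_curl hψ), E⟫_ℂ =
      ⟪ofContinuous L a ψ hψ.continuous, G⟫_ℂ := by
  have hcl : IsClosed {w : L2Field L a × L2Field L a |
      ⟪ofContinuous L a (curl ψ) (continuous_curl hψ), w.1⟫_ℂ =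
        ⟪ofContinuous L a ψ hψ.continuous, w.2⟫_ℂ} :=
    isClosed_eq (continuous_const.inner continuous_fst) (continuous_const.inner continuous_snd)
  refine closure_minimal ?_ hcl h
  rintro _ ⟨F, hF, rfl⟩
  change ⟪_, _⟫_ℂ = ⟪_, _⟫_ℂ
  rw [inner_ofContinuous_ofContinuous, inner_ofContinuous_ofContinuous]
  exact integral_inner_curl_left hL ha hψ hp hF

theorem hasWeakCurl_of_mem_closure {L a : ℝ} (hL : 0 < L) (ha : 0 < a) {E G : L2Field L a}
    (h : (E, G) ∈ (smoothPECGraph L a).topologicalClosure) : HasWeakCurl E G := fun ψ hψ => by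
  rw [← inner_ofContinuous (continuous_curl hψ.smooth), ← inner_ofContinuous
    hψ.smooth.continuous]
  exact inner_curl_of_mem_closure hL ha h hψ.smooth hψ.periodic

/-- The magnetic mode is used as `ψ`; its tangential cosines do not vanish at the plates, so the
weak curl alone would not justify this. -/
theorem inner_modeField_curl {L a : ℝ} (hL : 0 < L) (ha : 0 < a) {E G : L2Field L a}
    (h : (E, G) ∈ (smoothPECGraph L a).topologicalClosure) (i : Fin 3) (m : ℤ × ℤ) (n : ℕ) :
    ⟪modeField L a (fieldType true i) i m n, G⟫_ℂ = ∑ k,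
      starRingEnd ℂ (curlCoeff L a true m n i k) *
        ⟪modeField L a (fieldType false k) k m n, E⟫_ℂ := by
  rw [modeField, ← inner_curl_of_mem_closure hL ha h
    (contDiff_axisField i (contDiff_scalarMode L a _ m n))
    (periodic_axisField i (periodic_scalarMode hL a _ m n)), ofContinuous_curl_mode, sum_inner]
  simp only [inner_smul_left, Bool.not_true]

theorem inner_modeField_of_mem_divFree {L a : ℝ} (hL : 0 < L) (ha : 0 < a) {E : L2Field L a}
    (hE : E ∈ divFree L a) (m : ℤ × ℤ) (n : ℕ) :
    Complex.I * (kx L m * ⟪modeField L a false 0 m n, E⟫_ℂ +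
      ky L m * ⟪modeField L a false 1 m n, E⟫_ℂ) -
      nu a n * ⟪modeField L a true 2 m n, E⟫_ℂ = 0 := by
  have h := integral_inner_grad_scalarMode hL ha hE m n
  have hg : ofContinuous L a (grad (scalarMode L a false m n))
      (continuous_grad (contDiff_scalarMode L a false m n)) = ∑ i,
        (![Complex.I * kx L m, Complex.I * ky L m, (nu a n : ℂ)] : Fin 3 → ℂ) i •
          modeField L a (fieldType false i) i m n := by
    refine ofContinuous_eq_sum _ _ m n _ fun p i => ?_
    fin_cases i <;> simp [grad, fieldType, pd_ex_scalarMode, pd_ey_scalarMode, pd_ez_scalarMode,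
      zSign]
  rw [← inner_ofContinuous (continuous_grad (contDiff_scalarMode L a false m n)), hg,
    Fin.sum_univ_three] at h
  simp only [inner_add_left, inner_smul_left] at h
  simp [fieldType] at h
  linear_combination -h

/-- Lagrange's identity `|κ × w|² + |κ · w|² = |κ|² |w|²` for `κ = (x, y, v)` and `w = (A, B, i C)`,
up to unimodular factors. -/
theorem cross_norm_sq (x y v : ℝ) (A B C : ℂ) :
    ‖-v * B + Complex.I * y * C‖ ^ 2 + ‖v * A - Complex.I * x * C‖ ^ 2 +
        ‖-(Complex.I * y) * A + Complex.I * x * B‖ ^ 2 +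
        ‖Complex.I * (x * A + y * B) - v * C‖ ^ 2 =
      (x ^ 2 + y ^ 2 + v ^ 2) * (‖A‖ ^ 2 + ‖B‖ ^ 2 + ‖C‖ ^ 2) := by
  simp only [Complex.sq_norm, Complex.normSq_apply]
  simp
  ring

/-- The coefficients of a field of type `false`. -/
def modeCoeff {L a : ℝ} (E : L2Field L a) (i : Fin 3) (j : (ℤ × ℤ) × ℕ) : ℂ :=
  ⟪modeField L a (fieldType false i) i j.1 j.2, E⟫_ℂ

/-- Parseval for `G` in the magnetic basis: its coefficients are the cross product in
`cross_norm_sq`, and the divergence constraint removes the remaining square. -/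
theorem hasSum_norm_sq_curl {L a : ℝ} (hL : 0 < L) (ha : 0 < a) {E G : L2Field L a}
    (h : (E, G) ∈ (smoothPECGraph L a).topologicalClosure) (hE : E ∈ divFree L a) :
    HasSum (fun j : (ℤ × ℤ) × ℕ => lam L a j.1 j.2 * ∑ i, ‖modeCoeff E i j‖ ^ 2)
      (‖G‖ ^ 2) := by
  refine (hasSum_fiber_norm_sq hL ha (fieldType true) G).congr_fun fun j => ?_
  obtain ⟨m, n⟩ := j
  simp only [inner_modeField_curl hL ha h]
  have hc := cross_norm_sq (kx L m) (ky L m) (nu a n) ⟪modeField L a false 0 m n, E⟫_ℂ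
    ⟪modeField L a false 1 m n, E⟫_ℂ ⟪modeField L a true 2 m n, E⟫_ℂ
  rw [inner_modeField_of_mem_divFree hL ha hE] at hc
  simp only [Fin.sum_univ_three, modeCoeff]
  simp [curlCoeff, fieldType, zSign] at hc ⊢
  rw [lam, kSq, ← hc]
  ring_nf

/-! ### Fields with given coefficients -/

theorem summable_norm_sq_mul {ι : Type} {w : ι → ℝ} {d e : ι → ℂ}
    (h : Summable fun j => w j * ‖d j‖ ^ 2) (he : ∀ j, ‖e j‖ ^ 2 ≤ w j) :
    Summable fun j => ‖d j * e j‖ ^ 2 := by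
  refine Summable.of_nonneg_of_le (fun j => sq_nonneg _) (fun j => ?_) h
  rw [norm_mul, mul_pow, mul_comm]
  exact mul_le_mul_of_nonneg_right (he j) (sq_nonneg _)

/-- Partial sums are smooth perfect-conductor fields. Their curls converge because the squared curl
coefficients are at most `λ_{m,n}`, so the pair of limits lies in the closed graph. -/
theorem exists_mem_closure_of_summable {L a : ℝ} (hL : 0 < L) (ha : 0 < a) (i : Fin 3)
    {d : (ℤ × ℤ) × ℕ → ℂ} (h : Summable fun j => lam L a j.1 j.2 * ‖d j‖ ^ 2)
    {E : L2Field L a}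
    (hE : HasSum (fun j => d j • modeField L a (fieldType false i) i j.1 j.2) E) :
    ∃ G, (E, G) ∈ (smoothPECGraph L a).topologicalClosure := by
  have hs : Summable fun j : (ℤ × ℤ) × ℕ => d j •
      ofContinuous L a (curl (axisField i (scalarMode L a (fieldType false i) j.1 j.2)))
        (continuous_curl (contDiff_axisField i (contDiff_scalarMode L a _ j.1 j.2))) := by
    simp only [ofContinuous_curl_mode, Finset.smul_sum, smul_smul]
    have hk : ∀ k, Summable fun j : (ℤ × ℤ) × ℕ => (d j * curlCoeff L a false j.1 j.2 i k) •
        modeField L a (fieldType (!false) k) k j.1 j.2 := fun k =>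
      summable_smul_modeField hL ha _ k
        (summable_norm_sq_mul h fun j => norm_sq_curlCoeff_le L a false j.1 j.2 i k)
    exact summable_sum fun k _ => hk k
  obtain ⟨G, hG⟩ := hs
  refine ⟨G, (smoothPECGraph L a).isClosed_topologicalClosure.mem_of_tendsto
    (HasSum.prodMk hE hG) (Filter.Eventually.of_forall fun s => ?_)⟩
  refine Submodule.sum_mem _ fun j _ => ?_
  exact Submodule.smul_mem _ (d j) ((smoothPECGraph L a).le_topologicalClosure
    (show (modeField L a (fieldType false i) i j.1 j.2, ofContinuous L a (curl _) _) ∈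
      smoothPECGraph L a from ⟨_, isSmoothPEC_mode hL ha i j.1 j.2, rfl⟩))

/-- After integration by parts all three components share one integral against `φ_m s_n` and differ
only by a scalar factor. The three pairings thus combine into a multiple of the divergence
constraint. -/
theorem inner_grad_modeField {L a : ℝ} (hL : 0 < L) (ha : 0 < a) {f : Pt → ℂ}
    (hf : IsTest L a f) (i : Fin 3) (m : ℤ × ℤ) (n : ℕ) :
    ⟪ofContinuous L a (grad f) (continuous_grad hf.smooth),
      modeField L a (fieldType false i) i m n⟫_ℂ =
      -(∫ p, starRingEnd ℂ (f p) * scalarMode L a false m n p ∂(slabMeasure L a)) *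
        (![Complex.I * kx L m, Complex.I * ky L m, -(nu a n : ℂ)] : Fin 3 → ℂ) i := by
  have hs := contDiff_scalarMode L a (fieldType false i) m n
  rw [modeField, inner_ofContinuous_ofContinuous]
  have e : ∀ p, ⟪grad f p, axisField i (scalarMode L a (fieldType false i) m n) p⟫_ℂ =
      starRingEnd ℂ (pd (axis i) f p) * scalarMode L a (fieldType false i) m n p := fun p => by
    rw [axisField, EuclideanSpace.inner_single_right, grad_apply, mul_comm]
  simp only [e]
  rw [integral_conj_pd_mul hL ha hf hs (periodic_scalarMode hL a _ m n), neg_mul,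
    ← integral_mul_const]
  congr 1
  refine integral_congr_ae (Filter.Eventually.of_forall fun p => ?_)
  fin_cases i <;> simp [axis, fieldType, pd_ex_scalarMode, pd_ey_scalarMode, pd_ez_scalarMode,
      zSign] <;> ring

theorem mem_divFree_of_hasSum {L a : ℝ} (hL : 0 < L) (ha : 0 < a)
    {A : Fin 3 → (ℤ × ℤ) × ℕ → ℂ}
    (hdiv : ∀ m n, Complex.I * (kx L m * A 0 (m, n) + ky L m * A 1 (m, n)) -
      nu a n * A 2 (m, n) = 0) {E : L2Field L a}
    (hE : HasSum (fun j => ∑ i, A i j • modeField L a (fieldType false i) i j.1 j.2) E) :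
    E ∈ divFree L a := by
  intro f hf
  rw [← inner_ofContinuous (continuous_grad hf.smooth)]
  have h := hE.mapL (innerSL ℂ (ofContinuous L a (grad f) (continuous_grad hf.smooth)))
  refine h.unique ?_
  convert hasSum_zero using 1
  funext j
  obtain ⟨m, n⟩ := j
  rw [innerSL_apply_apply, inner_sum]
  simp only [inner_smul_right, inner_grad_modeField hL ha hf, Fin.sum_univ_three]
  simp
  linear_combination -(∫ p, starRingEnd ℂ (f p) * scalarMode L a false m n p ∂(slabMeasure L a))
    * hdiv m n

/-- Graph convergence is obtained one component at a time; only the sum of the three fields is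
divergence free. -/
theorem exists_mem_VPEC {L a : ℝ} (hL : 0 < L) (ha : 0 < a) {A : Fin 3 → (ℤ × ℤ) × ℕ → ℂ}
    (hsum : ∀ i, Summable fun j => (1 + lam L a j.1 j.2) * ‖A i j‖ ^ 2)
    (hdiv : ∀ m n, Complex.I * (kx L m * A 0 (m, n) + ky L m * A 1 (m, n)) -
      nu a n * A 2 (m, n) = 0) :
    ∃ E ∈ VPEC L a,
      HasSum (fun j => ∑ i, A i j • modeField L a (fieldType false i) i j.1 j.2) E := by
  have h1 : ∀ i, Summable fun j => ‖A i j‖ ^ 2 := fun i =>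
    Summable.of_nonneg_of_le (fun j => sq_nonneg _) (fun j => le_mul_of_one_le_left (sq_nonneg _)
      (le_add_of_nonneg_right (lam_nonneg L a j.1 j.2))) (hsum i)
  have h2 : ∀ i, Summable fun j => lam L a j.1 j.2 * ‖A i j‖ ^ 2 := fun i =>
    ((hsum i).sub (h1 i)).congr fun j => by ring
  choose E hE using fun i => summable_smul_modeField hL ha (fieldType false i) i (h1 i)
  choose G hG using fun i => exists_mem_closure_of_summable hL ha i (h2 i) (hE i)
  have hmem := Submodule.sum_mem (smoothPECGraph L a).topologicalClosure
    (t := Finset.univ) fun i _ => hG i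
  have hEsum := hasSum_sum (s := Finset.univ) fun i _ => hE i
  have e : ∑ i, (E i, G i) = (∑ i, E i, ∑ i, G i) := Prod.ext Prod.fst_sum Prod.snd_sum
  rw [e] at hmem
  exact ⟨∑ i, E i, ⟨⟨∑ i, G i, hasWeakCurl_of_mem_closure hL ha hmem, hmem⟩,
    mem_divFree_of_hasSum hL ha hdiv hEsum⟩, hEsum⟩

/-! ### Splitting off the indices with `n = 0` -/

/-- The inclusion of the indices with `n ≥ 1`. -/
def posIndex (j : (ℤ × ℤ) × ℕ+) : (ℤ × ℤ) × ℕ := (j.1, (j.2 : ℕ))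

/-- The inclusion of the indices with `n = 0`. -/
def zeroIndex (m : ℤ × ℤ) : (ℤ × ℤ) × ℕ := (m, 0)

theorem posIndex_injective : Function.Injective posIndex := fun j k h => by
  simp only [posIndex, Prod.mk.injEq, PNat.coe_inj] at h
  exact Prod.ext h.1 h.2

theorem zeroIndex_injective : Function.Injective zeroIndex := fun _ _ h => congrArg Prod.fst h

theorem mem_range_posIndex {j : (ℤ × ℤ) × ℕ} (h : j.2 ≠ 0) : j ∈ Set.range posIndex :=
  ⟨(j.1, ⟨j.2, Nat.pos_of_ne_zero h⟩), rfl⟩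

theorem isCompl_range_posIndex : IsCompl (Set.range posIndex) (Set.range zeroIndex) := by
  rw [isCompl_iff, codisjoint_iff_le_sup, Set.disjoint_left]
  constructor
  · rintro _ ⟨j, rfl⟩ ⟨m, h⟩
    exact j.2.ne_zero (congrArg Prod.snd h).symm
  · intro j _
    by_cases h : j.2 = 0
    · exact Or.inr ⟨j.1, Prod.ext rfl h.symm⟩
    · exact Or.inl (mem_range_posIndex h)

theorem hasSum_of_posIndex_zeroIndex {f : (ℤ × ℤ) × ℕ → ℝ} {s t : ℝ}
    (h1 : HasSum (fun j => f (posIndex j)) s) (h2 : HasSum (fun m => f (zeroIndex m)) t) :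
    HasSum f (s + t) :=
  (posIndex_injective.hasSum_range_iff.2 h1).add_isCompl isCompl_range_posIndex
    (zeroIndex_injective.hasSum_range_iff.2 h2)

/-! ### Coefficients and reconstruction -/

theorem tangentialField_eq (L a : ℝ) (m : ℤ × ℤ) (n : ℕ) (u : EuclideanSpace ℂ (Fin 2)) :
    tangentialField L a m n u =
      u 0 • modeField L a false 0 m n + u 1 • modeField L a false 1 m n := by
  rw [tangentialField, ofContinuous_eq_sum (fieldType false) ![u 0, u 1, 0] m n _ fun p i => by
    fin_cases i <;> simp [fieldType, scalarMode, zMode], Fin.sum_univ_three]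
  simp [fieldType]

theorem normalField_eq (L a : ℝ) (m : ℤ × ℤ) (n : ℕ) (v : ℂ) :
    normalField L a m n v = v • modeField L a true 2 m n := by
  rw [normalField, ofContinuous_eq_sum (fieldType false) ![0, 0, v] m n _ fun p i => by
    fin_cases i <;> simp [fieldType, scalarMode, zMode], Fin.sum_univ_three]
  simp [fieldType]

theorem Reconstructs.unique {L a : ℝ} {c : Coeff} {E E' : L2Field L a} (h : Reconstructs c E)
    (h' : Reconstructs c E') : E = E' := by
  obtain ⟨T, N, hT, hN, rfl⟩ := h
  obtain ⟨T', N', hT', hN', rfl⟩ := h'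
  rw [hT.unique hT', hN.unique hN']

/-- The coefficient family of a field. -/
def coeffs (L a : ℝ) : L2Field L a →ₗ[ℂ] Coeff where
  toFun E := (fun j => !₂[modeCoeff E 0 (posIndex j), modeCoeff E 1 (posIndex j)],
    fun j => modeCoeff E 2 j)
  map_add' E E' := by
    refine Prod.ext (funext fun j => ?_) (funext fun j => ?_)
    · ext i
      fin_cases i <;> simp [modeCoeff, inner_add_right]
    · simp [modeCoeff, inner_add_right]
  map_smul' t E := by
    refine Prod.ext (funext fun j => ?_) (funext fun j => ?_)
    · ext i
      fin_cases i <;> simp [modeCoeff, inner_smul_right]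
    · simp [modeCoeff, inner_smul_right]

/-- Pairing with a mode is continuous, so by orthonormality it extracts a single term of the series.
Only `L²` convergence is used, hence this applies to families not yet known to lie in `CPEC`. -/
theorem Reconstructs.coeffs_eq {L a : ℝ} (hL : 0 < L) (ha : 0 < a) {c : Coeff} {E : L2Field L a}
    (h : Reconstructs c E) : coeffs L a E = c := by
  obtain ⟨T, N, hT, hN, rfl⟩ := h
  have hin : ∀ {ι : Type} {f : ι → L2Field L a} {S : L2Field L a} (x : L2Field L a),
      HasSum f S → HasSum (fun j => ⟪x, f j⟫_ℂ) ⟪x, S⟫_ℂ := fun x hf => hf.mapL (innerSL ℂ x)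
  simp only [tangentialField_eq] at hT
  simp only [normalField_eq] at hN
  have hN0 : ∀ i : Fin 3, i ≠ 2 → ∀ m n, ⟪modeField L a false i m n, N⟫_ℂ = 0 :=
    fun i hi m n => by
      refine (hin _ hN).unique ?_
      convert hasSum_zero using 2 with j
      rw [inner_smul_right, inner_modeField_of_ne _ _ hi, mul_zero]
  have hT2 : ∀ m n, ⟪modeField L a true 2 m n, T⟫_ℂ = 0 := fun m n => by
    refine (hin _ hT).unique ?_
    convert hasSum_zero using 2 with j
    rw [inner_add_right, inner_smul_right, inner_smul_right,
      inner_modeField_of_ne _ _ (by decide), inner_modeField_of_ne _ _ (by decide), mul_zero,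
      mul_zero, add_zero]
  have hz : ∀ (m : ℤ × ℤ) (n : ℕ+) (j : (ℤ × ℤ) × ℕ+), j ≠ (m, n) →
      ¬(m = j.1 ∧ (n : ℕ) = j.2) := fun m n j hj hc =>
    hj (Prod.ext hc.1.symm (PNat.coe_injective hc.2.symm))
  have hT0 : ∀ m (n : ℕ+), ⟪modeField L a false 0 m n, T⟫_ℂ = c.1 (m, n) 0 := fun m n => by
    refine (hin _ hT).unique ?_
    convert hasSum_single (m, n) fun j hj => ?_ using 1
    · rw [inner_add_right, inner_smul_right, inner_smul_right, inner_modeField hL ha,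
        inner_modeField_of_ne _ _ (by decide)]
      simp [zNormSq]
    · rw [inner_add_right, inner_smul_right, inner_smul_right, inner_modeField hL ha,
        inner_modeField_of_ne _ _ (by decide), if_neg (hz m n j hj)]
      simp
  have hT1 : ∀ m (n : ℕ+), ⟪modeField L a false 1 m n, T⟫_ℂ = c.1 (m, n) 1 := fun m n => by
    refine (hin _ hT).unique ?_
    convert hasSum_single (m, n) fun j hj => ?_ using 1
    · rw [inner_add_right, inner_smul_right, inner_smul_right, inner_modeField hL ha,
        inner_modeField_of_ne _ _ (by decide)]
      simp [zNormSq]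
    · rw [inner_add_right, inner_smul_right, inner_smul_right, inner_modeField hL ha,
        inner_modeField_of_ne _ _ (by decide), if_neg (hz m n j hj)]
      simp
  have hN2 : ∀ m n, ⟪modeField L a true 2 m n, N⟫_ℂ = c.2 (m, n) := fun m n => by
    refine (hin _ hN).unique ?_
    convert hasSum_single (m, n) fun j hj => ?_ using 1
    · rw [inner_smul_right, inner_modeField hL ha]
      simp [zNormSq]
    · rw [inner_smul_right, inner_modeField hL ha,
        if_neg fun hc => hj (Prod.ext hc.1.symm hc.2.symm), mul_zero]
  refine Prod.ext (funext fun j => ?_) (funext fun j => ?_)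
  · ext i
    fin_cases i
    · change ⟪modeField L a false 0 j.1 j.2, T + N⟫_ℂ = c.1 j 0
      rw [inner_add_right, hT0, hN0 0 (by decide), add_zero]
    · change ⟪modeField L a false 1 j.1 j.2, T + N⟫_ℂ = c.1 j 1
      rw [inner_add_right, hT1, hN0 1 (by decide), add_zero]
  · change ⟪modeField L a true 2 j.1 j.2, T + N⟫_ℂ = c.2 j
    rw [inner_add_right, hT2, hN2, zero_add]

theorem reconstructs_of_hasSum {L a : ℝ} (hL : 0 < L) (ha : 0 < a)
    {A : Fin 3 → (ℤ × ℤ) × ℕ → ℂ} (hA : ∀ i, Summable fun j => ‖A i j‖ ^ 2)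
    {E : L2Field L a}
    (hE : HasSum (fun j => ∑ i, A i j • modeField L a (fieldType false i) i j.1 j.2) E) :
    Reconstructs (fun j => !₂[A 0 (posIndex j), A 1 (posIndex j)], A 2) E := by
  choose S hS using fun i => summable_smul_modeField hL ha (fieldType false i) i (hA i)
  refine ⟨S 0 + S 1, S 2, ?_, ?_, ?_⟩
  · simp only [tangentialField_eq]
    -- The tangential series over `ℕ+` agrees with the one over `ℕ` because its additional terms are
    -- zero fields.
    refine (posIndex_injective.hasSum_iff fun j hj => ?_).2 ((hS 0).add (hS 1))
    have h0 : j.2 = 0 := by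
      by_contra h
      exact hj (mem_range_posIndex h)
    change A 0 j • modeField L a false 0 j.1 j.2 + A 1 j • modeField L a false 1 j.1 j.2 = 0
    rw [h0, modeField_false_zero, modeField_false_zero, smul_zero, smul_zero, add_zero]
  · simp only [normalField_eq]
    exact hS 2
  · rw [hE.unique (hasSum_sum (s := Finset.univ) fun i _ => hS i), Fin.sum_univ_three]

theorem summable_norm_sq_modeCoeff {L a : ℝ} (hL : 0 < L) (ha : 0 < a) (E : L2Field L a)
    (i : Fin 3) : Summable fun j => ‖modeCoeff E i j‖ ^ 2 :=
  Summable.of_nonneg_of_le (fun _ => sq_nonneg _)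
    (fun _ => Finset.single_le_sum (f := fun i => ‖modeCoeff E i _‖ ^ 2)
      (fun _ _ => sq_nonneg _) (Finset.mem_univ i))
    (hasSum_fiber_norm_sq hL ha (fieldType false) E).summable

theorem reconstructs_coeffs {L a : ℝ} (hL : 0 < L) (ha : 0 < a) (E : L2Field L a) :
    Reconstructs (coeffs L a E) E :=
  reconstructs_of_hasSum hL ha (summable_norm_sq_modeCoeff hL ha E)
    (hasSum_fiber_basisField hL ha (fieldType false) E)

theorem sum_norm_sq_posIndex {L a : ℝ} (E : L2Field L a) (j : (ℤ × ℤ) × ℕ+) :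
    ∑ i, ‖modeCoeff E i (posIndex j)‖ ^ 2 =
      ‖(coeffs L a E).1 j‖ ^ 2 + ‖(coeffs L a E).2 (j.1, (j.2 : ℕ))‖ ^ 2 := by
  rw [EuclideanSpace.norm_sq_eq, Fin.sum_univ_two, Fin.sum_univ_three]
  rfl

theorem sum_norm_sq_zeroIndex {L a : ℝ} (E : L2Field L a) (m : ℤ × ℤ) :
    ∑ i, ‖modeCoeff E i (zeroIndex m)‖ ^ 2 = ‖(coeffs L a E).2 (m, 0)‖ ^ 2 := by
  have h : ∀ i, ⟪modeField L a false i m 0, E⟫_ℂ = 0 := fun i => by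
    rw [modeField_false_zero, inner_zero_left]
  have h0 : modeCoeff E 0 (zeroIndex m) = 0 := h 0
  have h1 : modeCoeff E 1 (zeroIndex m) = 0 := h 1
  rw [Fin.sum_univ_three, h0, h1, norm_zero, zero_pow two_ne_zero, zero_add, zero_add]
  rfl

theorem lam_zeroIndex (L a : ℝ) (m : ℤ × ℤ) : lam L a m 0 = kSq L m := by
  rw [lam, nu_zero, zero_pow two_ne_zero, add_zero]

theorem hasSum_norm_sq_of_mem_VPEC {L a : ℝ} (hL : 0 < L) (ha : 0 < a) {E G : L2Field L a}
    (hE : E ∈ VPEC L a) (hG : HasWeakCurl E G) :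
    HasSum (fun j : (ℤ × ℤ) × ℕ => lam L a j.1 j.2 * ∑ i, ‖modeCoeff E i j‖ ^ 2)
      (‖G‖ ^ 2) := by
  obtain ⟨⟨G', hG', hcl⟩, hdiv⟩ := hE
  rw [hG.unique hL ha hG']
  exact hasSum_norm_sq_curl hL ha hcl hdiv

/-- The weight `1 + λ_{m,n}` splits into Parseval for `E` and Parseval for its curl. At `n = 0` only
the normal coefficient survives and `λ_{m,0} = |k_m|²`. -/
theorem coeffs_mem_CPEC {L a : ℝ} (hL : 0 < L) (ha : 0 < a) {E : L2Field L a}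
    (hE : E ∈ VPEC L a) : coeffs L a E ∈ CPEC L a := by
  obtain ⟨G, hG, -⟩ := hE.1
  have hs : Summable fun j : (ℤ × ℤ) × ℕ =>
      (1 + lam L a j.1 j.2) * ∑ i, ‖modeCoeff E i j‖ ^ 2 := by
    simp only [add_mul, one_mul]
    exact (hasSum_fiber_norm_sq hL ha (fieldType false) E).summable.add
      (hasSum_norm_sq_of_mem_VPEC hL ha hE hG).summable
  refine ⟨(hs.comp_injective posIndex_injective).congr fun j => ?_,
    (hs.comp_injective zeroIndex_injective).congr fun m => ?_, fun m n => ?_⟩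
  · rw [Function.comp_apply, sum_norm_sq_posIndex]
    rfl
  · rw [Function.comp_apply, sum_norm_sq_zeroIndex]
    change (1 + lam L a m 0) * _ = _
    rw [lam_zeroIndex]
  · exact inner_modeField_of_mem_divFree hL ha hE.2 m n

theorem exists_reconstructs_of_mem_CPEC {L a : ℝ} (hL : 0 < L) (ha : 0 < a) {c : Coeff}
    (hc : c ∈ CPEC L a) : ∃ E ∈ VPEC L a, Reconstructs c E := by
  obtain ⟨h1, h2, h3⟩ := hc
  -- Extension by `0` at `n = 0` makes the weighted sum over `n = 0` exactly the second summability
  -- condition. It also makes the divergence constraint trivial there, since `ν_0 = 0`.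
  let u : Fin 2 → (ℤ × ℤ) × ℕ → ℂ := fun i j =>
    if h : 0 < j.2 then c.1 (j.1, ⟨j.2, h⟩) i else 0
  let A : Fin 3 → (ℤ × ℤ) × ℕ → ℂ := ![u 0, u 1, c.2]
  have hu : ∀ i j, u i (posIndex j) = c.1 j i := fun i j => dif_pos j.2.pos
  have hu0 : ∀ i m, u i (zeroIndex m) = 0 := fun i m => dif_neg (lt_irrefl 0)
  have hpos : ∀ j, ∑ i, ‖A i (posIndex j)‖ ^ 2 = ‖c.1 j‖ ^ 2 + ‖c.2 (j.1, (j.2 : ℕ))‖ ^ 2 :=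
    fun j => by
      rw [EuclideanSpace.norm_sq_eq, Fin.sum_univ_two, Fin.sum_univ_three, ← hu, ← hu]
      rfl
  have hzero : ∀ m, ∑ i, ‖A i (zeroIndex m)‖ ^ 2 = ‖c.2 (m, 0)‖ ^ 2 := fun m => by
    rw [Fin.sum_univ_three]
    change ‖u 0 (zeroIndex m)‖ ^ 2 + ‖u 1 (zeroIndex m)‖ ^ 2 + ‖c.2 (m, 0)‖ ^ 2 = _
    rw [hu0, hu0, norm_zero, zero_pow two_ne_zero, zero_add, zero_add]
  have hw : ∀ j : (ℤ × ℤ) × ℕ, 0 ≤ 1 + lam L a j.1 j.2 := fun j =>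
    add_nonneg zero_le_one (lam_nonneg L a j.1 j.2)
  have hs : Summable fun j : (ℤ × ℤ) × ℕ => (1 + lam L a j.1 j.2) * ∑ i, ‖A i j‖ ^ 2 := by
    refine (hasSum_of_posIndex_zeroIndex (h1.congr fun j => ?_).hasSum
      (h2.congr fun m => ?_).hasSum).summable
    · rw [hpos]
      rfl
    · rw [hzero]
      change _ = (1 + lam L a m 0) * _
      rw [lam_zeroIndex]
  have hsA : ∀ i, Summable fun j : (ℤ × ℤ) × ℕ => (1 + lam L a j.1 j.2) * ‖A i j‖ ^ 2 := fun i =>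
    Summable.of_nonneg_of_le (fun j => mul_nonneg (hw j) (sq_nonneg _))
      (fun j => mul_le_mul_of_nonneg_left (Finset.single_le_sum (f := fun i => ‖A i j‖ ^ 2)
        (fun _ _ => sq_nonneg _) (Finset.mem_univ i)) (hw j)) hs
  have hdiv : ∀ m n, Complex.I * (kx L m * A 0 (m, n) + ky L m * A 1 (m, n)) -
      nu a n * A 2 (m, n) = 0 := fun m n => by
    rcases Nat.eq_zero_or_pos n with rfl | hn
    · have e0 : A 0 (m, 0) = 0 := hu0 0 m
      have e1 : A 1 (m, 0) = 0 := hu0 1 m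
      rw [e0, e1, nu_zero]
      simp
    · have e0 : A 0 (m, n) = c.1 (m, ⟨n, hn⟩) 0 := hu 0 (m, ⟨n, hn⟩)
      have e1 : A 1 (m, n) = c.1 (m, ⟨n, hn⟩) 1 := hu 1 (m, ⟨n, hn⟩)
      rw [e0, e1]
      exact h3 m ⟨n, hn⟩
  obtain ⟨E, hE, hsum⟩ := exists_mem_VPEC hL ha hsA hdiv
  refine ⟨E, hE, ?_⟩
  have hrec := reconstructs_of_hasSum hL ha (fun i => Summable.of_nonneg_of_le
    (fun j => sq_nonneg _) (fun j => le_mul_of_one_le_left (sq_nonneg _)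
      (le_add_of_nonneg_right (lam_nonneg L a j.1 j.2))) (hsA i)) hsum
  convert hrec using 1
  refine Prod.ext (funext fun j => ?_) rfl
  ext i
  fin_cases i
  · exact (hu 0 j).symm
  · exact (hu 1 j).symm

/-! ### The coefficient isomorphism -/

/-- The coefficient map from `V_PEC` to `𝔠_PEC`. -/
def coeffMap {L a : ℝ} (hL : 0 < L) (ha : 0 < a) : VPEC L a →ₗ[ℂ] CPEC L a :=
  ((coeffs L a).domRestrict (VPEC L a)).codRestrict (CPEC L a) fun E =>
    coeffs_mem_CPEC hL ha E.2

/-- Injective because every field is the sum of its own mode series; surjective because every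
admissible family reconstructs a field of `VPEC` whose coefficients are that family. -/
theorem coeffMap_bijective {L a : ℝ} (hL : 0 < L) (ha : 0 < a) :
    Function.Bijective (coeffMap hL ha) := by
  constructor
  · intro E E' h
    have h' : coeffs L a E = coeffs L a E' := congrArg Subtype.val h
    have hr := reconstructs_coeffs hL ha (E : L2Field L a)
    rw [h'] at hr
    exact Subtype.ext (hr.unique (reconstructs_coeffs hL ha (E' : L2Field L a)))
  · intro c
    obtain ⟨E, hE, hr⟩ := exists_reconstructs_of_mem_CPEC hL ha c.2
    exact ⟨⟨E, hE⟩, Subtype.ext (hr.coeffs_eq hL ha)⟩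

/-- The reconstruction isomorphism from `𝔠_PEC` to `V_PEC`. -/
def reconstruction {L a : ℝ} (hL : 0 < L) (ha : 0 < a) : CPEC L a ≃ₗ[ℂ] VPEC L a :=
  (LinearEquiv.ofBijective (coeffMap hL ha) (coeffMap_bijective hL ha)).symm

theorem coeffs_reconstruction {L a : ℝ} (hL : 0 < L) (ha : 0 < a) (c : CPEC L a) :
    coeffs L a (reconstruction hL ha c : L2Field L a) = c :=
  congrArg Subtype.val
    ((LinearEquiv.ofBijective (coeffMap hL ha) (coeffMap_bijective hL ha)).apply_symm_apply c)

theorem hzero_eq_modeField {L a : ℝ} (hL : 0 < L) :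
    hzero L a = modeField L a true 2 (0, 0) 0 := by
  refine ofContinuous_congr L a _ _ fun p => ?_
  have h : Real.sqrt (L ^ 2 * a) = L * Real.sqrt a := by
    rw [Real.sqrt_mul (sq_nonneg L), Real.sqrt_sq hL.le]
  rw [h]
  ext i
  fin_cases i <;> simp [axisField, scalarMode, phi, kx, ky, zMode, cMode]
  ring

/-- The field `h₀` is the normal mode at `m = 0`, `n = 0`, so orthogonality to it is the vanishing
of one coefficient. Membership in the closure `HPEC` is automatic. -/
theorem mem_Vphys_iff {L a : ℝ} (hL : 0 < L) {E : L2Field L a} (hE : E ∈ VPEC L a) :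
    E ∈ Vphys L a ↔ (coeffs L a E).2 ((0, 0), 0) = 0 := by
  have hin : E ∈ HPEC L a := Submodule.le_topologicalClosure _ hE
  have e : (coeffs L a E).2 ((0, 0), 0) = ⟪hzero L a, E⟫_ℂ := by
    rw [hzero_eq_modeField hL]
    rfl
  rw [e, ← Submodule.mem_orthogonal_singleton_iff_inner_right]
  exact ⟨fun h => h.2.2, fun h => ⟨hE, hin, h⟩⟩

end PECSlab

end

/-! ### The coefficient description of `VPEC` and `Vphys`. -/

open PECSlab
theorem lemma3p1 (L a : ℝ) (hL : 0 < L) (ha : 0 < a) :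
    ∃ Φ : CPEC L a ≃ₗ[ℂ] VPEC L a,
      -- `Φ` is the reconstruction map
      (∀ c : CPEC L a, Reconstructs (c : Coeff) (Φ c : L2Field L a)) ∧
      -- a field of `V_PEC` has no other expansion
      (∀ (c : Coeff) (E : VPEC L a), Reconstructs c (E : L2Field L a) →
        ∃ hc : c ∈ CPEC L a, Φ ⟨c, hc⟩ = E) ∧
      -- diagonal form of the curl norm
      (∀ (c : CPEC L a) (G : L2Field L a), HasWeakCurl (Φ c : L2Field L a) G →
        Summable (fun j : (ℤ × ℤ) × ℕ+ =>
          lam L a j.1 j.2 *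
            (‖(c : Coeff).1 j‖ ^ 2 + ‖(c : Coeff).2 (j.1, (j.2 : ℕ))‖ ^ 2)) ∧
        Summable (fun m : ℤ × ℤ => kSq L m * ‖(c : Coeff).2 (m, 0)‖ ^ 2) ∧
        ‖G‖ ^ 2 =
          (∑' j : (ℤ × ℤ) × ℕ+, lam L a j.1 j.2 *
            (‖(c : Coeff).1 j‖ ^ 2 + ‖(c : Coeff).2 (j.1, (j.2 : ℕ))‖ ^ 2)) +
          ∑' m : ℤ × ℤ, kSq L m * ‖(c : Coeff).2 (m, 0)‖ ^ 2) ∧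
      -- the reduced spaces correspond
      (∀ c : CPEC L a, (c : Coeff) ∈ Cphys L a ↔ (Φ c : L2Field L a) ∈ Vphys L a) := by
  refine ⟨reconstruction hL ha, fun c => ?_, fun c E h => ?_, fun c G hG => ?_, fun c => ?_⟩
  · have h := reconstructs_coeffs hL ha (reconstruction hL ha c : L2Field L a)
    rwa [coeffs_reconstruction] at h
  · have hc := h.coeffs_eq hL ha
    -- The family equals the coefficients of a field of `VPEC`, so its weighted summability and
    -- constraint come from the field.
    have hm : c ∈ CPEC L a := hc ▸ coeffs_mem_CPEC hL ha E.2
    refine ⟨hm, Subtype.ext ?_⟩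
    have h' := reconstructs_coeffs hL ha (reconstruction hL ha ⟨c, hm⟩ : L2Field L a)
    rw [coeffs_reconstruction] at h'
    exact h'.unique h
  · have h := hasSum_norm_sq_of_mem_VPEC hL ha (reconstruction hL ha c).2 hG
    have e1 : ∀ j : (ℤ × ℤ) × ℕ+, lam L a (posIndex j).1 (posIndex j).2 *
        ∑ i, ‖modeCoeff (reconstruction hL ha c : L2Field L a) i (posIndex j)‖ ^ 2 =
        lam L a j.1 j.2 *
          (‖(c : Coeff).1 j‖ ^ 2 + ‖(c : Coeff).2 (j.1, (j.2 : ℕ))‖ ^ 2) := fun j => by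
      rw [sum_norm_sq_posIndex, coeffs_reconstruction]
      rfl
    have e2 : ∀ m : ℤ × ℤ, lam L a (zeroIndex m).1 (zeroIndex m).2 *
        ∑ i, ‖modeCoeff (reconstruction hL ha c : L2Field L a) i (zeroIndex m)‖ ^ 2 =
        kSq L m * ‖(c : Coeff).2 (m, 0)‖ ^ 2 := fun m => by
      rw [sum_norm_sq_zeroIndex, coeffs_reconstruction, ← lam_zeroIndex L a m]
      rfl
    have s1 := (h.summable.comp_injective posIndex_injective).congr e1
    have s2 := (h.summable.comp_injective zeroIndex_injective).congr e2
    refine ⟨s1, s2, h.unique (hasSum_of_posIndex_zeroIndex ?_ ?_)⟩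
    · exact s1.hasSum.congr_fun e1
    · exact s2.hasSum.congr_fun e2
  · rw [mem_Vphys_iff hL (reconstruction hL ha c).2, coeffs_reconstruction]
    exact ⟨fun h => h.2, fun h => ⟨c.2, h⟩⟩
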